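/- Let $G$ be a simple graph with vertex set $\{1,\dots,n\}$ and $m\ge 1$ edges, accessible through degree queries (the answer is $d(v)$) and neighbor queries (the answer is the $i$-th neighbor of $v$ in an arbitrary fixed order for $1\le i\le d(v)$, and a special symbol otherwise). Let $\alpha\in\mathbb R$ and $\epsilon,\delta\in(0,1)$. An edge is called high if both of its endpoints have degree larger than $2\alpha/\epsilon$. An almost uniform edge sampler with accuracy $\eta$ is a randomized query algorithm $S$ that, given $n$, $\eta$ and $\delta'\in(0,1)$, halts with probability $1$, returning an edge of $G$ or the message that no edge is returned, such that an edge is returned with probability at least $1-\delta'$ and each edge is returned with probability in $[(1-\eta)/m,(1+\eta)/m]$. The procedure Estimate-high-edges$(n,\alpha,\epsilon,\delta)$ uses such a sampler $S$ with accuracy $0.1$. It sets $r=\lceil 100\lceil\log_2(2/\delta)\rceil/\epsilon\rceil$ and $\delta'=\delta/(2r)$. It invokes $S(n,0.1,\delta')$ up to $r$ times, and if some invocation returns no edge, it returns FEW. Otherwise it determines by degree queries the fraction $\chi$ of the $r$ returned edges that are high. It returns MANY if $\chi>2.6\epsilon$, and FEW otherwise. (a) For every almost uniform edge sampler $S$ with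 accuracy $0.1$, the procedure returns, with probability $1$, a value in $\{\text{MANY},\text{FEW}\}$, and: 1. if $G$ has more than $4\epsilon m$ high edges, then it returns MANY with probability at least $1-\delta$; 2. if $G$ has at most $2\epsilon m$ high edges, then it returns FEW with probability at least $1-\delta$. (b) There is an almost uniform edge sampler $S$ with accuracy $0.1$ whose expected query complexity and running time are at most $C\,\frac{n}{\sqrt{0.1\,m}}\,(1+\log n)^k(1+\log(1/\delta'))^k$ for some constants $C,k$, and for which the expected query complexity and running time of Estimate-high-edges are $$\tilde O\Big(\frac{n}{\sqrt m}\cdot\frac{\log(1/\epsilon)}{\epsilon}\Big)\cdot\mathrm{poly}(\log(1/\delta)),$$ that is, at most $C'\,\frac{n}{\sqrt m}\cdot\frac{1+\log(1/\epsilon)}{\epsilon}\,(1+\log n)^{k'}(1+\log(1/\delta))^{k'}$ for constants $C',k'$ that do not depend on $G,n,\alpha,\epsilon,\delta$. Algorithms are finite programs over real-valued registers with unit-cost arithmetic operations, comparisons, draws of uniform random integers, and queries. -/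

import Mathlib

open scoped ENNReal

noncomputable section

/-! ### Query access to a graph -/

/-- A simple graph on `n` vertices together with an arbitrary ordering of the neighbors of each
vertex (its incidence lists). -/
structure QueryGraph (n : ℕ) where
  graph : SimpleGraph (Fin n)
  nbr : (v : Fin n) → Fin (graph.neighborSet v).ncard ≃ graph.neighborSet v

namespace QueryGraph

variable {n : ℕ}

/-- The degree `d(v)`. -/
def deg (Q : QueryGraph n) (v : Fin n) : ℕ := (Q.graph.neighborSet v).ncard

/-- The number `m` of edges. -/
def numEdges (Q : QueryGraph n) : ℕ := Q.graph.edgeSet.ncard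

/-- The number of high edges: edges both of whose endpoints have degree above `2α/ε`. -/
def numHighEdges (Q : QueryGraph n) (α ε : ℝ) : ℕ :=
  {e ∈ Q.graph.edgeSet | ∀ v ∈ e, 2 * α / ε < (Q.deg v : ℝ)}.ncard

end QueryGraph

/-- Algorithms refer to the `n` vertices by the numbers `1, …, n`. -/
def vertexLabel {n : ℕ} (v : Fin n) : ℝ := (v : ℝ) + 1

open Classical in
/-- The vertex that a number refers to, if there is one. -/
def vertexAt (n : ℕ) (x : ℝ) : Option (Fin n) :=
  if h : ∃ v : Fin n, vertexLabel v = x then some h.choose else none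

/-- Answer to a degree query (`0` if `x` does not denote a vertex). -/
def QueryGraph.degAnswer {n : ℕ} (Q : QueryGraph n) (x : ℝ) : ℝ :=
  match vertexAt n x with
  | some v => Q.deg v
  | none => 0

open Classical in
/-- Answer to the query for the `y`-th neighbor of `x`, where `1 ≤ y ≤ d(x)`; any other query is
answered by the special symbol `0`, which is not the label of a vertex. -/
def QueryGraph.nbrAnswer {n : ℕ} (Q : QueryGraph n) (x y : ℝ) : ℝ :=
  match vertexAt n x with
  | some v =>
      if h : ∃ i : Fin (Q.graph.neighborSet v).ncard, (i : ℝ) + 1 = y then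
        vertexLabel (Q.nbr v h.choose : Fin n)
      else 0
  | none => 0

/-! ### Randomized query algorithms and their running time

Algorithms are finite programs over registers of type `ρ` that hold real numbers. There are no
operations besides the four arithmetic operations, comparison, drawing a uniform integer, and the
two kinds of queries, each at unit cost. -/

/-- Contents of the registers. -/
abbrev Store (ρ : Type) := ρ → ℝ

/-- Elementary instructions; the first argument is the register that is written. -/
inductive Instr (ρ : Type) where
  | const (x : ρ) (c : ℚ)
  | copy (x y : ρ)
  | add (x y z : ρ)
  | sub (x y z : ρ)
  | mul (x y z : ρ)
  | div (x y z : ρ)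
  /-- a uniformly random element of `{1, …, k}`, where `k` is the integer part of register `y` -/
  | rand (x y : ρ)
  /-- degree query on the vertex in register `y` -/
  | degree (x y : ρ)
  /-- query for the neighbor number `z` of the vertex in register `y` -/
  | neighbor (x y z : ρ)

/-- Programs. -/
inductive Prog (ρ : Type) where
  | skip
  | op (i : Instr ρ)
  | seq (a b : Prog ρ)
  /-- if `x < y` then `a` else `b` -/
  | ite (x y : ρ) (a b : Prog ρ)
  /-- while `x < y` do `a` -/
  | loop (x y : ρ) (a : Prog ρ)

/-- Renaming of the registers of an instruction. -/
def Instr.map {ρ ρ' : Type} (f : ρ → ρ') : Instr ρ → Instr ρ'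
  | const x c => const (f x) c
  | copy x y => copy (f x) (f y)
  | add x y z => add (f x) (f y) (f z)
  | sub x y z => sub (f x) (f y) (f z)
  | mul x y z => mul (f x) (f y) (f z)
  | div x y z => div (f x) (f y) (f z)
  | rand x y => rand (f x) (f y)
  | degree x y => degree (f x) (f y)
  | neighbor x y z => neighbor (f x) (f y) (f z)

/-- Renaming of the registers of a program. -/
def Prog.map {ρ ρ' : Type} (f : ρ → ρ') : Prog ρ → Prog ρ'
  | skip => skip
  | op i => op (i.map f)
  | seq a b => seq (a.map f) (b.map f)
  | ite x y a b => ite (f x) (f y) (a.map f) (b.map f)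
  | loop x y a => loop (f x) (f y) (a.map f)

/-- Sequential composition of a list of programs. -/
def Prog.block {ρ : Type} : List (Prog ρ) → Prog ρ
  | [] => skip
  | c :: cs => seq c (block cs)

/-- The number of queries (`0` or `1`) that an instruction makes. -/
def Instr.queries {ρ : Type} : Instr ρ → ℕ
  | degree _ _ => 1
  | neighbor _ _ _ => 1
  | _ => 0

/-- A uniformly random element of `{1, …, k}` (and `0` if `k = 0`). -/
def uniformUpTo (k : ℕ) : PMF ℝ :=
  match k with
  | 0 => PMF.pure 0
  | j + 1 => (PMF.uniformOfFintype (Fin (j + 1))).map fun i => (i : ℝ) + 1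

section Semantics

variable {n : ℕ} {ρ : Type} [DecidableEq ρ]

/-- The effect of one instruction on the store. -/
def Instr.eval (Q : QueryGraph n) (σ : Store ρ) : Instr ρ → PMF (Store ρ)
  | const x c => PMF.pure (Function.update σ x (c : ℝ))
  | copy x y => PMF.pure (Function.update σ x (σ y))
  | add x y z => PMF.pure (Function.update σ x (σ y + σ z))
  | sub x y z => PMF.pure (Function.update σ x (σ y - σ z))
  | mul x y z => PMF.pure (Function.update σ x (σ y * σ z))
  | div x y z => PMF.pure (Function.update σ x (σ y / σ z))
  | rand x y => (uniformUpTo ⌊σ y⌋₊).map fun r => Function.update σ x r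
  | degree x y => PMF.pure (Function.update σ x (Q.degAnswer (σ y)))
  | neighbor x y z => PMF.pure (Function.update σ x (Q.nbrAnswer (σ y) (σ z)))

/-- A configuration: the programs that remain to be executed (first one first), the store, and the
number of queries made so far. -/
structure Config (ρ : Type) where
  stack : List (Prog ρ)
  store : Store ρ
  queries : ℕ

open Classical in
/-- One step of execution. A configuration with empty stack has halted. -/
def step (Q : QueryGraph n) : Config ρ → PMF (Config ρ)
  | ⟨[], σ, q⟩ => PMF.pure ⟨[], σ, q⟩
  | ⟨.skip :: K, σ, q⟩ => PMF.pure ⟨K, σ, q⟩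
  | ⟨.op i :: K, σ, q⟩ => (i.eval Q σ).map fun σ' => ⟨K, σ', q + i.queries⟩
  | ⟨.seq a b :: K, σ, q⟩ => PMF.pure ⟨a :: b :: K, σ, q⟩
  | ⟨.ite x y a b :: K, σ, q⟩ => PMF.pure ⟨(if σ x < σ y then a else b) :: K, σ, q⟩
  | ⟨.loop x y a :: K, σ, q⟩ =>
      PMF.pure ⟨if σ x < σ y then a :: .loop x y a :: K else K, σ, q⟩

/-- The distribution of the configuration after `t` steps. -/
def runSteps (Q : QueryGraph n) (c : Config ρ) : ℕ → PMF (Config ρ)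
  | 0 => PMF.pure c
  | t + 1 => (runSteps Q c t).bind (step Q)

/-- The initial configuration of program `P` with store `σ`. -/
def Prog.start (P : Prog ρ) (σ : Store ρ) : Config ρ := ⟨[P], σ, 0⟩

/-- The probability that `P`, started with store `σ`, halts with a store in `A`. -/
def haltProb (Q : QueryGraph n) (P : Prog ρ) (σ : Store ρ) (A : Set (Store ρ)) : ℝ≥0∞ :=
  ⨆ t : ℕ, (runSteps Q (P.start σ) t).toOuterMeasure {c | c.stack = [] ∧ c.store ∈ A}

/-- The expected running time, `∑ₜ Pr[not halted after t steps]`. -/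
def expectedTime (Q : QueryGraph n) (P : Prog ρ) (σ : Store ρ) : ℝ≥0∞ :=
  ∑' t : ℕ, (runSteps Q (P.start σ) t).toOuterMeasure {c | c.stack ≠ []}

/-- The expected number of queries. -/
def expectedQueries (Q : QueryGraph n) (P : Prog ρ) (σ : Store ρ) : ℝ≥0∞ :=
  ⨆ t : ℕ, ∑' c : Config ρ, runSteps Q (P.start σ) t c * (c.queries : ℝ≥0∞)

end Semantics

/-! ### Procedures for sampling an edge almost uniformly

Such a procedure is a program over registers `0, 1, 2, …`. It is called with the parameters
`n`, `η`, `δ` in the registers `0`, `1`, `2` and arbitrary values in the others. It returns the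
labels of the endpoints of an edge in the registers `3` and `4`; the value `0` in register `3` says
that no edge is returned. -/

/-- The parameters `n`, `η`, `δ` are loaded. -/
def SamplerInput (n : ℕ) (η δ : ℝ) (σ : Store ℕ) : Prop :=
  σ 0 = n ∧ σ 1 = η ∧ σ 2 = δ

/-- The stores in which edge `e` is returned (in either orientation). -/
def returnsEdge {n : ℕ} (e : Sym2 (Fin n)) : Set (Store ℕ) :=
  {σ | ∃ u v : Fin n, e = s(u, v) ∧ σ 3 = vertexLabel u ∧ σ 4 = vertexLabel v}

/-- Some edge of the graph is returned. -/
def returnsSomeEdge {n : ℕ} (Q : QueryGraph n) : Set (Store ℕ) :=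
  {σ | ∃ e ∈ Q.graph.edgeSet, σ ∈ returnsEdge e}

/-- No edge is returned. -/
def returnsNoEdge : Set (Store ℕ) := {σ | σ 3 = 0}

/-- On every graph with at least one edge, `S` called with accuracy `η` and any `δ ∈ (0,1)` returns
an edge or reports that none is returned, returns an edge with probability at least `1 - δ`, and
returns each edge with probability in `[(1-η)/m, (1+η)/m]`. -/
def SamplesAlmostUniformly (S : Prog ℕ) (η : ℝ) : Prop :=
  ∀ (n : ℕ) (Q : QueryGraph n) (δ : ℝ) (σ : Store ℕ),
    0 < Q.numEdges → 0 < δ → δ < 1 → SamplerInput n η δ σ →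
      haltProb Q S σ (returnsSomeEdge Q ∪ returnsNoEdge) = 1 ∧
      ENNReal.ofReal (1 - δ) ≤ haltProb Q S σ (returnsSomeEdge Q) ∧
      ∀ e ∈ Q.graph.edgeSet,
        ENNReal.ofReal ((1 - η) / Q.numEdges) ≤ haltProb Q S σ (returnsEdge e) ∧
        haltProb Q S σ (returnsEdge e) ≤ ENNReal.ofReal ((1 + η) / Q.numEdges)

/-- With accuracy `η`, the expected query complexity and running time of `S` are
`Õ(n / √(η m)) · polylog(1/δ)`, where `Õ` hides factors polylogarithmic in `n`. -/
def SamplerComplexity (S : Prog ℕ) (η : ℝ) : Prop :=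
  ∃ (C : ℝ) (k : ℕ), ∀ (n : ℕ) (Q : QueryGraph n) (δ : ℝ) (σ : Store ℕ),
    0 < Q.numEdges → 0 < δ → δ < 1 → SamplerInput n η δ σ →
      let bound := ENNReal.ofReal (C * (n / √(η * Q.numEdges)) * (1 + Real.log n) ^ k *
        (1 + Real.log (1 / δ)) ^ k)
      expectedQueries Q S σ ≤ bound ∧ expectedTime Q S σ ≤ bound

/-! ### The procedure Estimate-high-edges -/

/-- The registers of the procedure itself. -/
inductive Var where
  | n | α | ε | δ
  | zero | one | two | tmp | len | r | δ' | thr | i | count | failed | degU | degV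
  | out
  deriving DecidableEq

/-- The registers of the sampling procedure and those of Estimate-high-edges. -/
abbrev EheReg := ℕ ⊕ Var

/-- A register of Estimate-high-edges. -/
abbrev reg (x : Var) : EheReg := Sum.inr x

/-- A register of the sampling procedure. -/
abbrev sreg (j : ℕ) : EheReg := Sum.inl j

/-- Estimate-high-edges `(n, α, ε, δ)` with `S` as the procedure that samples edges. The answer in
register `out` is `1` for MANY and `0` for FEW. -/
def estimateHighEdges (S : Prog ℕ) : Prog EheReg :=
  .block [
    .op (.const (reg .zero) 0),
    .op (.const (reg .one) 1),
    .op (.const (reg .two) 2),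
    -- `len := ⌈log₂ (2/δ)⌉`
    .op (.const (reg .len) 0),
    .op (.copy (reg .tmp) (reg .δ)),
    .loop (reg .tmp) (reg .two) (.block [
      .op (.mul (reg .tmp) (reg .tmp) (reg .two)),
      .op (.add (reg .len) (reg .len) (reg .one))]),
    -- `r := ⌈100 * len / ε⌉`
    .op (.const (reg .tmp) 100),
    .op (.mul (reg .len) (reg .len) (reg .tmp)),
    .op (.const (reg .r) 0),
    .op (.const (reg .tmp) 0),
    .loop (reg .tmp) (reg .len) (.block [
      .op (.add (reg .r) (reg .r) (reg .one)),
      .op (.mul (reg .tmp) (reg .r) (reg .ε))]),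
    -- `δ' := δ / (2 * r)`
    .op (.mul (reg .tmp) (reg .two) (reg .r)),
    .op (.div (reg .δ') (reg .δ) (reg .tmp)),
    -- `thr := 2 * α / ε`
    .op (.mul (reg .tmp) (reg .two) (reg .α)),
    .op (.div (reg .thr) (reg .tmp) (reg .ε)),
    -- for `i` from `1` to `r`
    .op (.const (reg .count) 0),
    .op (.const (reg .failed) 0),
    .op (.const (reg .i) 0),
    .loop (reg .i) (reg .r) (.block [
      .op (.add (reg .i) (reg .i) (reg .one)),
      -- invoke `S (n, 0.1, δ')`
      .op (.copy (sreg 0) (reg .n)),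
      .op (.const (sreg 1) (1 / 10)),
      .op (.copy (sreg 2) (reg .δ')),
      S.map Sum.inl,
      .ite (sreg 3) (reg .one)
        -- no edge was returned: leave the loop, the answer will be FEW
        (.block [
          .op (.const (reg .failed) 1),
          .op (.copy (reg .i) (reg .r))])
        -- count the edge if both of its endpoints are high-degree vertices
        (.block [
          .op (.degree (reg .degU) (sreg 3)),
          .op (.degree (reg .degV) (sreg 4)),
          .ite (reg .thr) (reg .degU)
            (.ite (reg .thr) (reg .degV)
              (.op (.add (reg .count) (reg .count) (reg .one)))
              .skip)
            .skip])]),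
    .ite (reg .zero) (reg .failed)
      (.op (.const (reg .out) 0))
      -- MANY if `count / r > 2.6 * ε`, otherwise FEW
      (.block [
        .op (.div (reg .count) (reg .count) (reg .r)),
        .op (.const (reg .tmp) (26 / 10)),
        .op (.mul (reg .tmp) (reg .tmp) (reg .ε)),
        .ite (reg .tmp) (reg .count)
          (.op (.const (reg .out) 1))
          (.op (.const (reg .out) 0))])]

/-- The parameters `n`, `α`, `ε`, `δ` are loaded; the other registers may hold anything. -/
def EheInput (n : ℕ) (α ε δ : ℝ) (σ : Store EheReg) : Prop :=
  σ (reg .n) = n ∧ σ (reg .α) = α ∧ σ (reg .ε) = ε ∧ σ (reg .δ) = δ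

/-- The answer is MANY. -/
def answersMany : Set (Store EheReg) := {σ | σ (reg .out) = 1}

/-- The answer is FEW. -/
def answersFew : Set (Store EheReg) := {σ | σ (reg .out) = 0}

end

/-!
Whatever happened in the earlier calls of the sampler, the next edge is high with a probability
that differs from the proportion of high edges by a factor in `[0.9, 1.1]`. A Chernoff bound by
conditional expectations follows: a potential of exponential type in the number of remaining calls
and the number of high edges found so far is at most `δ` at the start, does not increase in
expectation, and is at least `1` when the answer is wrong.

The edge sampler relies on a degree threshold `θ` with `θ ^ 2 ≥ 40 m`, above which a vertex is
heavy. A random vertex and a random number up to `θ` hit every oriented edge that starts at a light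
vertex with the same probability. There are at most `2 m / θ ≤ θ / 20` heavy vertices, hence at most
a twentieth of the neighbors of a heavy vertex is heavy, and a random edge at the heavy endpoint of
a hit edge makes the orientations that start at heavy vertices almost as likely as the others. As
`m` is unknown, the `k`-th trial uses the threshold `A / k`. The trials with `k ≤ A / √(40 m)` all
fail with such a small probability that the later ones matter neither for the distribution of the
edge nor for the expected running time.
-/

noncomputable section

/-! ### Expected cost of programs -/

section Expectation

variable {α β : Type*}

/-- The expectation of a function with values in `[0, ∞]`. -/
def expectation (p : PMF α) (f : α → ℝ≥0∞) : ℝ≥0∞ := ∑' a, p a * f a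

theorem expectation_pure (a : α) (f : α → ℝ≥0∞) : expectation (PMF.pure a) f = f a := by
  classical
  rw [expectation, tsum_eq_single a fun b hb => by simp [PMF.pure_apply, hb]]
  simp

theorem expectation_bind (p : PMF α) (g : α → PMF β) (f : β → ℝ≥0∞) :
    expectation (p.bind g) f = expectation p fun a => expectation (g a) f := by
  simp only [expectation, PMF.bind_apply, ← ENNReal.tsum_mul_right, ← ENNReal.tsum_mul_left]
  rw [ENNReal.tsum_comm]
  simp only [mul_assoc]

theorem expectation_map (p : PMF α) (g : α → β) (f : β → ℝ≥0∞) :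
    expectation (p.map g) f = expectation p fun a => f (g a) := by
  simp only [← PMF.bind_pure_comp, expectation_bind, Function.comp_apply, expectation_pure]

theorem expectation_mono (p : PMF α) {f g : α → ℝ≥0∞} (h : ∀ a, f a ≤ g a) :
    expectation p f ≤ expectation p g :=
  ENNReal.tsum_le_tsum fun a => by gcongr; exact h a

theorem expectation_add (p : PMF α) (f g : α → ℝ≥0∞) :
    (expectation p fun a => f a + g a) = expectation p f + expectation p g := by
  simp only [expectation, mul_add, ENNReal.tsum_add]

theorem expectation_const (p : PMF α) (c : ℝ≥0∞) : (expectation p fun _ => c) = c := by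
  simp only [expectation, ENNReal.tsum_mul_right, PMF.tsum_coe, one_mul]

theorem expectation_const_mul (p : PMF α) (c : ℝ≥0∞) (f : α → ℝ≥0∞) :
    (expectation p fun a => c * f a) = c * expectation p f := by
  simp only [expectation, ← ENNReal.tsum_mul_left, mul_left_comm c]

theorem expectation_sum {ι : Type*} (p : PMF α) (s : Finset ι) (f : ι → α → ℝ≥0∞) :
    (expectation p fun a => ∑ i ∈ s, f i a) = ∑ i ∈ s, expectation p (f i) := by
  simp only [expectation, Finset.mul_sum]
  exact Summable.tsum_finsetSum fun _ _ => ENNReal.summable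

theorem expectation_iSup (p : PMF α) {f : ℕ → α → ℝ≥0∞} (h : Monotone f) :
    (expectation p fun a => ⨆ t, f t a) = ⨆ t, expectation p (f t) := by
  let _ : MeasurableSpace α := ⊤
  simp only [expectation, ENNReal.mul_iSup, ← MeasureTheory.lintegral_count]
  refine MeasureTheory.lintegral_iSup (fun _ => measurable_from_top) fun s t hst a => ?_
  exact mul_le_mul_right (h hst a) _

theorem toOuterMeasure_eq_expectation (p : PMF α) (s : Set α) :
    p.toOuterMeasure s = expectation p (s.indicator 1) := by
  classical
  rw [PMF.toOuterMeasure_apply]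
  refine tsum_congr fun a => ?_
  by_cases h : a ∈ s <;> simp [h]

theorem expectation_uniformUpTo {N : ℕ} (hN : 0 < N) (f : ℝ → ℝ≥0∞) :
    expectation (uniformUpTo N) f = (N : ℝ≥0∞)⁻¹ * ∑ j : Fin N, f ((j : ℝ) + 1) := by
  obtain ⟨j, rfl⟩ : ∃ j, N = j + 1 := ⟨N - 1, by omega⟩
  have h : uniformUpTo (j + 1) =
      (PMF.uniformOfFintype (Fin (j + 1))).map fun i : Fin (j + 1) => ((i : ℕ) : ℝ) + 1 := by
    simp only [uniformUpTo, bind_pure_comp, PMF.monad_map_eq_map, PMF.map_comp]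
    rfl
  rw [h, expectation_map, expectation, tsum_fintype]
  simp [Finset.mul_sum]

end Expectation

section Cost

variable {n : ℕ} {ρ : Type} [DecidableEq ρ]

open Classical in
/-- The expected value of `τ` per step plus `f` of the final store, over the first `t` steps from
the configuration `c`; runs that have not halted by then contribute no final value. -/
def costUpTo (Q : QueryGraph n) (τ : ℝ≥0∞) (f : Store ρ → ℝ≥0∞) : ℕ → Config ρ → ℝ≥0∞
  | 0, c => if c.stack = [] then f c.store else 0
  | t + 1, c => if c.stack = [] then f c.store else τ + expectation (step Q c) (costUpTo Q τ f t)

/-- The expected value of `τ` per step plus `f` of the final store of the runs that halt. -/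
def totalCost (Q : QueryGraph n) (τ : ℝ≥0∞) (f : Store ρ → ℝ≥0∞) (c : Config ρ) : ℝ≥0∞ :=
  ⨆ t, costUpTo Q τ f t c

/-- The cost of running `P`: expected running time (`τ = 1`, `f = 0`), the probability of halting
in a set (`τ = 0`, `f` its indicator) and the combinations needed to compose programs are all of
this form. As a function of `f` it is the weakest-precondition transformer of `P`. -/
def Prog.cost (P : Prog ρ) (Q : QueryGraph n) (τ : ℝ≥0∞) (f : Store ρ → ℝ≥0∞) (σ : Store ρ) :
    ℝ≥0∞ :=
  totalCost Q τ f (P.start σ)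

/-- The configuration `c` with the programs `K` scheduled after everything else. -/
def Config.append (c : Config ρ) (K : List (Prog ρ)) : Config ρ :=
  ⟨c.stack ++ K, c.store, c.queries⟩

variable (Q : QueryGraph n) (τ : ℝ≥0∞) (f : Store ρ → ℝ≥0∞)

theorem costUpTo_halted (t : ℕ) {c : Config ρ} (h : c.stack = []) :
    costUpTo Q τ f t c = f c.store := by
  cases t <;> simp [costUpTo, h]

theorem costUpTo_zero {c : Config ρ} (h : c.stack ≠ []) : costUpTo Q τ f 0 c = 0 := by
  simp [costUpTo, h]

theorem costUpTo_succ (t : ℕ) {c : Config ρ} (h : c.stack ≠ []) :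
    costUpTo Q τ f (t + 1) c = τ + expectation (step Q c) (costUpTo Q τ f t) := by
  simp [costUpTo, h]

theorem costUpTo_monotone : Monotone (costUpTo Q τ f) := by
  refine monotone_nat_of_le_succ fun t => ?_
  induction t with
  | zero =>
    intro c
    by_cases h : c.stack = [] <;> simp [costUpTo, h]
  | succ t ih =>
    intro c
    by_cases h : c.stack = []
    · simp only [costUpTo_halted Q τ f _ h, le_refl]
    · rw [costUpTo_succ _ _ _ _ h, costUpTo_succ _ _ _ _ h]
      gcongr
      exact expectation_mono _ ih

theorem costUpTo_le_totalCost (t : ℕ) (c : Config ρ) : costUpTo Q τ f t c ≤ totalCost Q τ f c :=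
  le_iSup (fun t => costUpTo Q τ f t c) t

theorem totalCost_halted {c : Config ρ} (h : c.stack = []) : totalCost Q τ f c = f c.store := by
  simp only [totalCost, costUpTo_halted Q τ f _ h, ciSup_const]

theorem totalCost_step {c : Config ρ} (h : c.stack ≠ []) :
    totalCost Q τ f c = τ + expectation (step Q c) (totalCost Q τ f) := by
  have hmono := costUpTo_monotone Q τ f
  have hmono_at : Monotone fun t => costUpTo Q τ f t c := fun s t hst => hmono hst c
  unfold totalCost
  rw [expectation_iSup _ hmono, ENNReal.add_iSup, ← hmono_at.iSup_nat_add 1]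
  exact iSup_congr fun t => costUpTo_succ _ _ _ _ h

theorem costUpTo_queries (t : ℕ) (K : List (Prog ρ)) (σ : Store ρ) (q q' : ℕ) :
    costUpTo Q τ f t ⟨K, σ, q⟩ = costUpTo Q τ f t ⟨K, σ, q'⟩ := by
  induction t generalizing K σ q q' with
  | zero => simp only [costUpTo]
  | succ t ih =>
    rcases K with _ | ⟨P, K⟩
    · simp only [costUpTo, if_true]
    rw [costUpTo_succ _ _ _ _ (by simp), costUpTo_succ _ _ _ _ (by simp)]
    congr 1
    cases P <;> simp only [step, expectation_pure, expectation_map]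
    case op i => congr 1; funext σ'; exact ih ..
    all_goals exact ih ..

theorem totalCost_queries (K : List (Prog ρ)) (σ : Store ρ) (q : ℕ) :
    totalCost Q τ f ⟨K, σ, q⟩ = totalCost Q τ f ⟨K, σ, 0⟩ :=
  iSup_congr fun t => costUpTo_queries Q τ f t K σ q 0

theorem step_append {c : Config ρ} (h : c.stack ≠ []) (K : List (Prog ρ)) :
    step Q (c.append K) = (step Q c).map (Config.append · K) := by
  rcases c with ⟨_ | ⟨P, K'⟩, σ, q⟩
  · exact absurd rfl h
  cases P <;> simp only [Config.append, List.cons_append, step, PMF.pure_map, PMF.map_comp,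
    Function.comp_def]
  case loop x y a => split_ifs <;> rfl

theorem totalCost_append_halted {c : Config ρ} (h : c.stack = []) (K : List (Prog ρ)) :
    totalCost Q τ f (c.append K) = totalCost Q τ f ⟨K, c.store, 0⟩ := by
  rw [Config.append, h, List.nil_append, totalCost_queries]

theorem totalCost_append (c : Config ρ) (K : List (Prog ρ)) :
    totalCost Q τ f (c.append K) = totalCost Q τ (fun σ => totalCost Q τ f ⟨K, σ, 0⟩) c := by
  have append_ne_nil {c : Config ρ} (h : c.stack ≠ []) : (c.append K).stack ≠ [] := by
    simp [Config.append, h]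
  refine le_antisymm (iSup_le fun t => ?_) (iSup_le fun t => ?_)
  · induction t generalizing c with
    | zero =>
      by_cases h : c.stack = []
      · rw [totalCost_halted _ _ _ h, ← totalCost_append_halted Q τ f h]
        exact costUpTo_le_totalCost ..
      · simp [costUpTo_zero Q τ f (append_ne_nil h)]
    | succ t ih =>
      by_cases h : c.stack = []
      · rw [totalCost_halted _ _ _ h, ← totalCost_append_halted Q τ f h]
        exact costUpTo_le_totalCost ..
      · rw [costUpTo_succ _ _ _ _ (append_ne_nil h), totalCost_step _ _ _ h, step_append _ h,
          expectation_map]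
        gcongr
        exact expectation_mono _ ih
  · induction t generalizing c with
    | zero =>
      by_cases h : c.stack = []
      · rw [costUpTo_halted _ _ _ _ h, totalCost_append_halted _ _ _ h]
      · simp [costUpTo_zero Q τ _ h]
    | succ t ih =>
      by_cases h : c.stack = []
      · rw [costUpTo_halted _ _ _ _ h, totalCost_append_halted _ _ _ h]
      · rw [costUpTo_succ _ _ _ _ h, totalCost_step _ _ _ (append_ne_nil h), step_append _ h,
          expectation_map]
        gcongr
        exact expectation_mono _ ih

theorem totalCost_cons (P : Prog ρ) (K : List (Prog ρ)) (σ : Store ρ) (q : ℕ) :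
    totalCost Q τ f ⟨P :: K, σ, q⟩ = P.cost Q τ (fun σ' => totalCost Q τ f ⟨K, σ', 0⟩) σ := by
  rw [totalCost_queries]
  exact totalCost_append Q τ f (P.start σ) K

theorem totalCost_nil (σ : Store ρ) (q : ℕ) : totalCost Q τ f ⟨[], σ, q⟩ = f σ :=
  totalCost_halted Q τ f rfl

namespace Prog

theorem cost_eq_expectation_step (P : Prog ρ) (σ : Store ρ) :
    P.cost Q τ f σ = τ + expectation (step Q (P.start σ)) (totalCost Q τ f) :=
  totalCost_step Q τ f (by simp [start])

theorem cost_skip (σ : Store ρ) : (skip : Prog ρ).cost Q τ f σ = τ + f σ := by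
  simp only [cost_eq_expectation_step, start, step, expectation_pure, totalCost_nil]

theorem cost_op (i : Instr ρ) (σ : Store ρ) :
    (op i).cost Q τ f σ = τ + expectation (i.eval Q σ) f := by
  simp only [cost_eq_expectation_step, start, step, expectation_map, totalCost_nil]

theorem cost_seq (a b : Prog ρ) (σ : Store ρ) :
    (seq a b).cost Q τ f σ = τ + a.cost Q τ (b.cost Q τ f) σ := by
  simp only [cost_eq_expectation_step (P := seq a b), start, step, expectation_pure,
    totalCost_cons, totalCost_nil]

variable {x y : ρ} {a b : Prog ρ} {σ : Store ρ}

theorem cost_ite_pos (h : σ x < σ y) : (ite x y a b).cost Q τ f σ = τ + a.cost Q τ f σ := by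
  simp only [cost_eq_expectation_step (P := ite x y a b), start, step, expectation_pure,
    totalCost_cons, totalCost_nil, if_pos h]

theorem cost_ite_neg (h : ¬σ x < σ y) : (ite x y a b).cost Q τ f σ = τ + b.cost Q τ f σ := by
  simp only [cost_eq_expectation_step (P := ite x y a b), start, step, expectation_pure,
    totalCost_cons, totalCost_nil, if_neg h]

theorem cost_loop_pos (h : σ x < σ y) :
    (loop x y a).cost Q τ f σ = τ + a.cost Q τ ((loop x y a).cost Q τ f) σ := by
  rw [cost_eq_expectation_step]
  simp only [start, step, expectation_pure, if_pos h, totalCost_cons, totalCost_nil]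

theorem cost_loop_neg (h : ¬σ x < σ y) : (loop x y a).cost Q τ f σ = τ + f σ := by
  simp only [cost_eq_expectation_step, start, step, expectation_pure, if_neg h, totalCost_nil]

theorem cost_block_cons (a : Prog ρ) (L : List (Prog ρ)) (σ : Store ρ) :
    (block (a :: L)).cost Q τ f σ = τ + a.cost Q τ ((block L).cost Q τ f) σ :=
  cost_seq Q τ f a (block L) σ

theorem cost_block_nil (σ : Store ρ) : (block ([] : List (Prog ρ))).cost Q τ f σ = τ + f σ :=
  cost_skip Q τ f σ

theorem cost_zero_block_nil : (block ([] : List (Prog ρ))).cost Q 0 f = f := by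
  funext σ
  rw [cost_block_nil, zero_add]

variable {f} in
theorem cost_mono {g : Store ρ → ℝ≥0∞} (h : ∀ σ, f σ ≤ g σ) (P : Prog ρ) (σ : Store ρ) :
    P.cost Q τ f σ ≤ P.cost Q τ g σ := by
  refine iSup_mono fun t => ?_
  generalize P.start σ = c
  induction t generalizing c with
  | zero => simp only [costUpTo]; split_ifs <;> simp [h]
  | succ t ih =>
    simp only [costUpTo]
    split_ifs
    · exact h _
    · gcongr
      exact expectation_mono _ ih

theorem cost_add (τ' : ℝ≥0∞) (g : Store ρ → ℝ≥0∞) (P : Prog ρ) (σ : Store ρ) :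
    P.cost Q (τ + τ') (fun σ => f σ + g σ) σ = P.cost Q τ f σ + P.cost Q τ' g σ := by
  have hadd (t : ℕ) (c : Config ρ) : costUpTo Q (τ + τ') (fun σ => f σ + g σ) t c =
      costUpTo Q τ f t c + costUpTo Q τ' g t c := by
    induction t generalizing c with
    | zero => simp only [costUpTo]; split_ifs <;> simp
    | succ t ih =>
      simp only [costUpTo]
      split_ifs
      · rfl
      · rw [funext ih, expectation_add, add_add_add_comm]
  simp only [cost, totalCost, hadd]
  exact (ENNReal.iSup_add_iSup_of_monotone (fun s t h => costUpTo_monotone Q τ f h _)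
    (fun s t h => costUpTo_monotone Q τ' g h _)).symm

theorem cost_zero_add (g : Store ρ → ℝ≥0∞) (P : Prog ρ) (σ : Store ρ) :
    P.cost Q 0 (fun σ => f σ + g σ) σ = P.cost Q 0 f σ + P.cost Q 0 g σ := by
  simpa only [add_zero] using cost_add Q 0 f 0 g P σ

theorem cost_eq_time_add (P : Prog ρ) (σ : Store ρ) :
    P.cost Q τ f σ = P.cost Q τ (fun _ => 0) σ + P.cost Q 0 f σ := by
  simpa only [add_zero, zero_add] using cost_add Q τ (fun _ => 0) 0 f P σ

theorem cost_const_mul (a : ℝ≥0∞) (P : Prog ρ) (σ : Store ρ) :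
    P.cost Q (a * τ) (fun σ => a * f σ) σ = a * P.cost Q τ f σ := by
  simp only [cost, totalCost, ENNReal.mul_iSup]
  refine iSup_congr fun t => ?_
  generalize P.start σ = c
  induction t generalizing c with
  | zero => simp only [costUpTo]; split_ifs <;> simp
  | succ t ih =>
    simp only [costUpTo]
    split_ifs
    · rfl
    · rw [funext ih, expectation_const_mul, mul_add]

theorem cost_zero_const_mul (a : ℝ≥0∞) (P : Prog ρ) (σ : Store ρ) :
    P.cost Q 0 (fun σ => a * f σ) σ = a * P.cost Q 0 f σ := by
  simpa only [mul_zero] using cost_const_mul Q 0 f a P σ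

theorem cost_zero_sum {ι : Type*} (s : Finset ι) (g : ι → Store ρ → ℝ≥0∞) (P : Prog ρ)
    (σ : Store ρ) :
    P.cost Q 0 (fun σ => ∑ i ∈ s, g i σ) σ = ∑ i ∈ s, P.cost Q 0 (g i) σ := by
  classical
  induction s using Finset.induction_on with
  | empty => simpa using cost_zero_const_mul Q (fun _ => 0) 0 P σ
  | insert i s hi ih => simp only [Finset.sum_insert hi, cost_zero_add, ih]

end Prog

theorem runSteps_succ' (c : Config ρ) (t : ℕ) :
    runSteps Q c (t + 1) = (step Q c).bind fun c' => runSteps Q c' t := by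
  induction t with
  | zero => simp [runSteps]
  | succ t ih =>
    rw [runSteps, ih, PMF.bind_bind]
    rfl

theorem runSteps_halted (σ : Store ρ) (q t : ℕ) :
    runSteps Q ⟨[], σ, q⟩ t = PMF.pure ⟨[], σ, q⟩ := by
  induction t with
  | zero => rfl
  | succ t ih => simp [runSteps, ih, step]

theorem haltProb_eq_cost (P : Prog ρ) (σ : Store ρ) (A : Set (Store ρ)) :
    haltProb Q P σ A = P.cost Q 0 (A.indicator 1) σ := by
  classical
  refine iSup_congr fun t => ?_
  generalize P.start σ = c
  rw [toOuterMeasure_eq_expectation]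
  induction t generalizing c with
  | zero =>
    rw [runSteps, expectation_pure]
    by_cases h : c.stack = [] <;> simp [costUpTo, h, Set.indicator]
  | succ t ih =>
    rcases c with ⟨_ | ⟨P, K⟩, σ, q⟩
    · rw [runSteps_halted, expectation_pure]
      simp [costUpTo, Set.indicator]
    · rw [runSteps_succ', expectation_bind, costUpTo_succ _ _ _ _ (by simp), zero_add]
      simp only [ih]

theorem haltProb_le_one (P : Prog ρ) (σ : Store ρ) (A : Set (Store ρ)) :
    haltProb Q P σ A ≤ 1 := by
  refine iSup_le fun t => ?_
  rw [toOuterMeasure_eq_expectation]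
  exact (expectation_mono _ fun c => Set.indicator_le_self' (fun _ _ => zero_le) c).trans_eq
    (expectation_const _ 1)

theorem haltProb_union (P : Prog ρ) (σ : Store ρ) {A B : Set (Store ρ)} (h : Disjoint A B) :
    haltProb Q P σ (A ∪ B) = haltProb Q P σ A + haltProb Q P σ B := by
  simp only [haltProb_eq_cost, Set.indicator_union_of_disjoint h, Prog.cost_zero_add]

variable {f} in
theorem Prog.cost_zero_le {a : ℝ≥0∞} (h : ∀ σ, f σ ≤ a) (P : Prog ρ) (σ : Store ρ) :
    P.cost Q 0 f σ ≤ a :=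
  calc P.cost Q 0 f σ ≤ P.cost Q 0 (fun σ => a * Set.univ.indicator 1 σ) σ :=
        cost_mono Q 0 (by simpa using h) P σ
    _ = a * haltProb Q P σ Set.univ := by rw [cost_zero_const_mul, ← haltProb_eq_cost]
    _ ≤ a := mul_le_of_le_one_right' (haltProb_le_one Q P σ _)

theorem costUpTo_one_zero (t : ℕ) (c : Config ρ) :
    costUpTo Q 1 (fun _ => 0) t c =
      ∑ s ∈ Finset.range t, (runSteps Q c s).toOuterMeasure {c | c.stack ≠ []} := by
  simp only [toOuterMeasure_eq_expectation]
  induction t generalizing c with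
  | zero => simp [costUpTo]
  | succ t ih =>
    rcases c with ⟨_ | ⟨P, K⟩, σ, q⟩
    · simp [costUpTo, runSteps_halted, expectation_pure]
    · rw [costUpTo_succ _ _ _ _ (by simp), Finset.sum_range_succ', add_comm]
      congr 1
      · simp only [funext ih, expectation_sum, runSteps_succ', expectation_bind]
      · simp [runSteps, expectation_pure]

theorem expectedTime_eq_cost (P : Prog ρ) (σ : Store ρ) :
    expectedTime Q P σ = P.cost Q 1 (fun _ => 0) σ := by
  rw [expectedTime, ENNReal.tsum_eq_iSup_nat]
  exact iSup_congr fun t => (costUpTo_one_zero Q t _).symm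

theorem expectation_step_queries_le (c : Config ρ) :
    expectation (step Q c) (fun c => (c.queries : ℝ≥0∞)) ≤
      c.queries + ({c | c.stack ≠ []} : Set (Config ρ)).indicator 1 c := by
  rcases c with ⟨_ | ⟨P, K⟩, σ, q⟩
  · simp [step, expectation_pure]
  · cases P <;> simp only [step, expectation_pure, expectation_map, expectation_const]
    case op i => cases i <;> simp [Instr.queries]
    all_goals simp

theorem expectedQueries_le_expectedTime (P : Prog ρ) (σ : Store ρ) :
    expectedQueries Q P σ ≤ expectedTime Q P σ := by
  rw [expectedTime, ENNReal.tsum_eq_iSup_nat]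
  refine iSup_mono fun t => ?_
  change expectation (runSteps Q (P.start σ) t) (fun c => (c.queries : ℝ≥0∞)) ≤ _
  induction t with
  | zero => simp [runSteps, expectation_pure, Prog.start]
  | succ t ih =>
    rw [runSteps, expectation_bind, Finset.sum_range_succ, toOuterMeasure_eq_expectation]
    refine (expectation_mono _ (expectation_step_queries_le Q)).trans ?_
    rw [expectation_add]
    gcongr

end Cost

/-! ### Deterministic runs -/

section MaxTime

/-- A bound on the running time of a program that is finite if there are no loops. -/
def Prog.maxTime {ρ : Type} : Prog ρ → ℝ≥0∞
  | skip => 1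
  | op _ => 1
  | seq a b => 1 + (a.maxTime + b.maxTime)
  | ite _ _ a b => 1 + (a.maxTime + b.maxTime)
  | loop _ _ _ => ⊤

theorem Prog.time_le_maxTime {n : ℕ} {ρ : Type} [DecidableEq ρ] (Q : QueryGraph n) (P : Prog ρ)
    (σ : Store ρ) : P.cost Q 1 (fun _ => 0) σ ≤ P.maxTime := by
  induction P generalizing σ with
  | skip => simp [cost_skip, maxTime]
  | op i => simp [cost_op, expectation_const, maxTime]
  | seq a b iha ihb =>
    rw [cost_seq, cost_eq_time_add, maxTime]
    gcongr
    · exact iha σ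
    · exact cost_zero_le Q ihb a σ
  | ite x y a b iha ihb =>
    rw [maxTime]
    by_cases h : σ x < σ y
    · rw [cost_ite_pos _ _ _ h]
      gcongr
      exact (iha σ).trans le_self_add
    · rw [cost_ite_neg _ _ _ h]
      gcongr
      exact (ihb σ).trans le_add_self
  | loop => exact le_top

end MaxTime

section Renaming

variable {n : ℕ} {ρ ν : Type} [DecidableEq ρ] [DecidableEq ν]

/-- The configuration of a program that works on the left registers of a store whose right registers
hold `v`. -/
def Config.extend (v : Store ν) (c : Config ρ) : Config (ρ ⊕ ν) :=
  ⟨c.stack.map (Prog.map Sum.inl), Sum.elim c.store v, c.queries⟩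

theorem Instr.eval_map_inl (Q : QueryGraph n) (s : Store ρ) (v : Store ν) (i : Instr ρ) :
    (i.map (Sum.inl : ρ → ρ ⊕ ν)).eval Q (Sum.elim s v) =
      (i.eval Q s).map fun s' => Sum.elim s' v := by
  cases i <;>
    simp only [Instr.map, Instr.eval, PMF.pure_map, PMF.map_comp, Function.comp_def,
      Sum.update_elim_inl, Sum.elim_inl]

theorem step_extend (Q : QueryGraph n) (v : Store ν) (c : Config ρ) :
    step Q (c.extend v) = (step Q c).map (Config.extend v) := by
  rcases c with ⟨_ | ⟨P, K⟩, s, q⟩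
  · simp only [Config.extend, List.map_nil, step, PMF.pure_map]
  cases P <;> simp only [Config.extend, List.map_cons, Prog.map, step, PMF.pure_map, PMF.map_comp,
    Function.comp_def, Instr.eval_map_inl, Sum.elim_inl]
  case op i => cases i <;> rfl
  case ite x y a b => by_cases h : s x < s y <;> simp only [h, if_true, if_false]
  case loop x y a =>
    by_cases h : s x < s y <;> simp only [h, if_true, if_false, List.map_cons, Prog.map]

theorem costUpTo_extend (Q : QueryGraph n) (τ : ℝ≥0∞) (f : Store (ρ ⊕ ν) → ℝ≥0∞) (v : Store ν)
    (t : ℕ) (c : Config ρ) :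
    costUpTo Q τ f t (c.extend v) = costUpTo Q τ (fun s => f (Sum.elim s v)) t c := by
  have hstack (c : Config ρ) : (c.extend v).stack = [] ↔ c.stack = [] := by simp [Config.extend]
  induction t generalizing c with
  | zero =>
    simp only [costUpTo, hstack]
    rfl
  | succ t ih =>
    simp only [costUpTo, hstack, step_extend, expectation_map, ih]
    rfl

theorem Prog.cost_map_inl (Q : QueryGraph n) (τ : ℝ≥0∞) (f : Store (ρ ⊕ ν) → ℝ≥0∞) (P : Prog ρ)
    (σ : Store (ρ ⊕ ν)) :
    (P.map Sum.inl).cost Q τ f σ =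
      P.cost Q τ (fun s => f (Sum.elim s (σ ∘ Sum.inr))) (σ ∘ Sum.inl) := by
  have hstart : (P.map Sum.inl).start σ = (P.start (σ ∘ Sum.inl)).extend (σ ∘ Sum.inr) := by
    simp [start, Config.extend]
  simp only [cost, totalCost, hstart, costUpTo_extend]

end Renaming

section RunsTo

variable {n : ℕ} {ρ : Type} [DecidableEq ρ]

/-- A deterministic Hoare triple with running time: started with the store `σ`, the programs `L`
halt after exactly `T` steps in a fixed store, which has property `φ`. Here `T` includes the steps
that unfold the part `L` of a surrounding block. -/
def RunsTo (Q : QueryGraph n) (L : List (Prog ρ)) (σ : Store ρ) (T : ℕ)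
    (φ : Store ρ → Prop) : Prop :=
  ∃ σ', φ σ' ∧ ∀ (L' : List (Prog ρ)) (τ : ℝ≥0∞) (f : Store ρ → ℝ≥0∞),
    (Prog.block (L ++ L')).cost Q τ f σ = T * τ + (Prog.block L').cost Q τ f σ'

namespace RunsTo

variable {Q : QueryGraph n} {L L' : List (Prog ρ)} {σ : Store ρ} {T T' : ℕ}
  {φ ψ : Store ρ → Prop}

theorem nil (h : φ σ) : RunsTo Q [] σ 0 φ :=
  ⟨σ, h, fun L' τ f => by simp⟩

theorem op {i : Instr ρ} {σ' : Store ρ} (hi : i.eval Q σ = PMF.pure σ') (h : RunsTo Q L σ' T φ) :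
    RunsTo Q (.op i :: L) σ (T + 2) φ := by
  obtain ⟨σ'', hφ, hcost⟩ := h
  refine ⟨σ'', hφ, fun L' τ f => ?_⟩
  rw [List.cons_append, Prog.cost_block_cons, Prog.cost_op, hi, expectation_pure, hcost]
  push_cast
  ring

theorem append (h : RunsTo Q L σ T φ) (h' : ∀ σ', φ σ' → RunsTo Q L' σ' T' ψ) :
    RunsTo Q (L ++ L') σ (T + T') ψ := by
  obtain ⟨σ', hφ, hcost⟩ := h
  obtain ⟨σ'', hψ, hcost'⟩ := h' σ' hφ
  refine ⟨σ'', hψ, fun L'' τ f => ?_⟩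
  rw [List.append_assoc, hcost, hcost']
  push_cast
  ring

theorem loop {x y : ρ} {N : ℕ} {I : ℕ → Store ρ → Prop} (h0 : I 0 σ)
    (hbody : ∀ j < N, ∀ σ, I j σ → σ x < σ y ∧ RunsTo Q L σ T (I (j + 1)))
    (hexit : ∀ σ, I N σ → ¬σ x < σ y) :
    RunsTo Q [.loop x y (.block L)] σ (N * (T + 2) + 2) (I N) := by
  suffices h : ∃ σ', I N σ' ∧ ∀ (τ : ℝ≥0∞) (f : Store ρ → ℝ≥0∞),
      (Prog.loop x y (.block L)).cost Q τ f σ = (N * (T + 2) + 1 : ℕ) * τ + f σ' by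
    obtain ⟨σ', hI, hcost⟩ := h
    refine ⟨σ', hI, fun L' τ f => ?_⟩
    rw [List.singleton_append, Prog.cost_block_cons, hcost]
    push_cast
    ring
  induction N generalizing σ I with
  | zero =>
    refine ⟨σ, h0, fun τ f => ?_⟩
    rw [Prog.cost_loop_neg _ _ _ (hexit σ h0)]
    simp
  | succ N ih =>
    obtain ⟨hlt, σ₁, hI₁, hcost₁⟩ := hbody 0 (by omega) σ h0
    obtain ⟨σ', hI, hcost⟩ := ih (I := fun j => I (j + 1)) hI₁
      (fun j hj σ => hbody (j + 1) (by omega) σ) hexit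
    refine ⟨σ', hI, fun τ f => ?_⟩
    have hcost₁' := hcost₁ [] τ ((Prog.loop x y (.block L)).cost Q τ f)
    rw [List.append_nil, Prog.cost_block_nil] at hcost₁'
    rw [Prog.cost_loop_pos _ _ _ hlt, hcost₁', hcost]
    push_cast
    ring

end RunsTo

end RunsTo

section Queries

variable {n : ℕ}

theorem vertexLabel_injective : Function.Injective (vertexLabel : Fin n → ℝ) := by
  intro u v h
  simp only [vertexLabel, add_left_inj, Nat.cast_inj] at h
  exact Fin.ext h

theorem one_le_vertexLabel (v : Fin n) : 1 ≤ vertexLabel v := by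
  simp [vertexLabel]

theorem vertexAt_vertexLabel (v : Fin n) : vertexAt n (vertexLabel v) = some v := by
  have h : ∃ u : Fin n, vertexLabel u = vertexLabel v := ⟨v, rfl⟩
  rw [vertexAt, dif_pos h, vertexLabel_injective h.choose_spec]

namespace QueryGraph

variable (Q : QueryGraph n) (v : Fin n)

theorem degAnswer_vertexLabel : Q.degAnswer (vertexLabel v) = Q.deg v := by
  simp [degAnswer, vertexAt_vertexLabel]

theorem nbrAnswer_vertexLabel (i : Fin (Q.deg v)) :
    Q.nbrAnswer (vertexLabel v) ((i : ℝ) + 1) = vertexLabel (Q.nbr v i : Fin n) := by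
  have h : ∃ j : Fin (Q.graph.neighborSet v).ncard, (j : ℝ) + 1 = (i : ℝ) + 1 := ⟨i, rfl⟩
  have h' : h.choose = i := Fin.ext (Nat.cast_injective (add_right_cancel h.choose_spec))
  simp only [nbrAnswer, vertexAt_vertexLabel]
  rw [dif_pos h, h']

theorem nbrAnswer_of_deg_le {j : ℕ} (h : Q.deg v ≤ j) :
    Q.nbrAnswer (vertexLabel v) ((j : ℝ) + 1) = 0 := by
  simp only [nbrAnswer, vertexAt_vertexLabel]
  refine dif_neg fun ⟨i, hi⟩ => ?_
  simp only [add_left_inj, Nat.cast_inj] at hi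
  exact absurd (hi ▸ i.2) (not_lt.2 h)

end QueryGraph

end Queries

section NumDoublings

/-- The number of times that `x` has to be doubled before it reaches `y`, for positive `x`
and `y`. -/
def numDoublings (x y : ℝ) : ℕ := ⌈Real.logb 2 (y / x)⌉₊

variable {x y : ℝ}

theorem lt_numDoublings_iff (hx : 0 < x) (hy : 0 < y) {j : ℕ} :
    j < numDoublings x y ↔ x * 2 ^ j < y := by
  rw [numDoublings, Nat.lt_ceil, Real.lt_logb_iff_rpow_lt one_lt_two (by positivity),
    Real.rpow_natCast, lt_div_iff₀' hx]

theorem le_mul_two_pow_numDoublings (hx : 0 < x) (hy : 0 < y) :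
    y ≤ x * 2 ^ numDoublings x y :=
  not_lt.1 fun h => lt_irrefl _ ((lt_numDoublings_iff hx hy).2 h)

theorem numDoublings_pos (hx : 0 < x) (hxy : x < y) : 0 < numDoublings x y :=
  (lt_numDoublings_iff hx (hx.trans hxy)).2 (by simpa using hxy)

theorem numDoublings_mul_log_two_lt (hx : 0 < x) (hxy : x ≤ y) :
    numDoublings x y * Real.log 2 < Real.log (y / x) + Real.log 2 := by
  have : 0 < Real.log 2 := Real.log_pos one_lt_two
  have hlogb : 0 ≤ Real.logb 2 (y / x) := Real.logb_nonneg one_lt_two ((one_le_div hx).2 hxy)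
  calc numDoublings x y * Real.log 2 < (Real.logb 2 (y / x) + 1) * Real.log 2 := by
        gcongr
        exact Nat.ceil_lt_add_one hlogb
    _ = Real.log (y / x) + Real.log 2 := by
        rw [Real.logb]
        field_simp

theorem exp_neg_le_div_of_numDoublings_le (hx : 0 < x) (hy : 0 < y) {z : ℝ}
    (hz : numDoublings x y * Real.log 2 ≤ z) : Real.exp (-z) ≤ x / y :=
  calc Real.exp (-z) ≤ Real.exp (-(numDoublings x y * Real.log 2)) := by gcongr
    _ = (2 ^ numDoublings x y)⁻¹ := by
        rw [Real.exp_neg, Real.exp_nat_mul, Real.exp_log two_pos]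
    _ ≤ x / y := by
        rw [le_div_iff₀ hy, inv_mul_le_iff₀ (by positivity), mul_comm]
        exact le_mul_two_pow_numDoublings hx hy

end NumDoublings

namespace RunsTo

variable {n : ℕ} {ρ : Type} [DecidableEq ρ] {Q : QueryGraph n} {L : List (Prog ρ)} {σ : Store ρ}
  {T : ℕ} {φ ψ : Store ρ → Prop} {x y : ρ} {a b : Prog ρ}

theorem mono (hφψ : ∀ σ, φ σ → ψ σ) (h : RunsTo Q L σ T φ) : RunsTo Q L σ T ψ := by
  obtain ⟨σ', hφ, hcost⟩ := h
  exact ⟨σ', hφψ σ' hφ, hcost⟩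

theorem skip (h : RunsTo Q L σ T φ) : RunsTo Q (.skip :: L) σ (T + 2) φ := by
  obtain ⟨σ', hφ, hcost⟩ := h
  refine ⟨σ', hφ, fun L' τ f => ?_⟩
  rw [List.cons_append, Prog.cost_block_cons, Prog.cost_skip, hcost]
  push_cast
  ring

theorem block (h : RunsTo Q L σ T φ) : RunsTo Q [.block L] σ (T + 2) φ := by
  obtain ⟨σ', hφ, hcost⟩ := h
  refine ⟨σ', hφ, fun L' τ f => ?_⟩
  have hblock := hcost [] τ ((Prog.block L').cost Q τ f)
  rw [List.append_nil, Prog.cost_block_nil] at hblock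
  rw [List.singleton_append, Prog.cost_block_cons, hblock]
  push_cast
  ring

theorem ite_pos (hlt : σ x < σ y) (h : RunsTo Q (a :: L) σ T φ) :
    RunsTo Q (.ite x y a b :: L) σ (T + 1) φ := by
  obtain ⟨σ', hφ, hcost⟩ := h
  refine ⟨σ', hφ, fun L' τ f => ?_⟩
  have hcost := hcost L' τ f
  rw [List.cons_append, Prog.cost_block_cons] at hcost ⊢
  rw [Prog.cost_ite_pos _ _ _ hlt, hcost]
  push_cast
  ring

theorem ite_neg (hge : ¬σ x < σ y) (h : RunsTo Q (b :: L) σ T φ) :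
    RunsTo Q (.ite x y a b :: L) σ (T + 1) φ := by
  obtain ⟨σ', hφ, hcost⟩ := h
  refine ⟨σ', hφ, fun L' τ f => ?_⟩
  have hcost := hcost L' τ f
  rw [List.cons_append, Prog.cost_block_cons] at hcost ⊢
  rw [Prog.cost_ite_neg _ _ _ hge, hcost]
  push_cast
  ring

theorem exists_cost_block_eq (h : RunsTo Q L σ T φ) :
    ∃ σ', φ σ' ∧ ∀ (τ : ℝ≥0∞) (f : Store ρ → ℝ≥0∞),
      (Prog.block L).cost Q τ f σ = (T + 1) * τ + f σ' := by
  obtain ⟨σ', hφ, hcost⟩ := h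
  refine ⟨σ', hφ, fun τ f => ?_⟩
  have hblock := hcost [] τ f
  rw [List.append_nil, Prog.cost_block_nil] at hblock
  rw [hblock]
  ring

end RunsTo

section Outcomes

variable {n : ℕ}

/-- The stores in which an edge from `E` is returned. -/
def returnsEdgeIn (E : Set (Sym2 (Fin n))) : Set (Store ℕ) := ⋃ e ∈ E, returnsEdge e

theorem disjoint_returnsEdge {e e' : Sym2 (Fin n)} (h : e ≠ e') :
    Disjoint (returnsEdge e) (returnsEdge e') := by
  refine Set.disjoint_left.2 ?_
  rintro s ⟨u, v, rfl, hu, hv⟩ ⟨u', v', rfl, hu', hv'⟩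
  exact h (by rw [vertexLabel_injective (hu.symm.trans hu'),
    vertexLabel_injective (hv.symm.trans hv')])

theorem disjoint_returnsEdge_returnsNoEdge (e : Sym2 (Fin n)) :
    Disjoint (returnsEdge e) returnsNoEdge := by
  refine Set.disjoint_left.2 ?_
  rintro s ⟨u, v, -, hu, -⟩ h0
  have := one_le_vertexLabel u
  rw [← hu, show s 3 = 0 from h0] at this
  linarith

theorem returnsSomeEdge_eq (Q : QueryGraph n) :
    returnsSomeEdge Q = returnsEdgeIn Q.graph.edgeSet := by
  ext s
  simp [returnsSomeEdge, returnsEdgeIn]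

theorem disjoint_returnsSomeEdge_returnsNoEdge (Q : QueryGraph n) :
    Disjoint (returnsSomeEdge Q) returnsNoEdge := by
  simp only [returnsSomeEdge_eq, returnsEdgeIn, Set.disjoint_iUnion_left]
  exact fun e _ => disjoint_returnsEdge_returnsNoEdge e

theorem haltProb_returnsEdgeIn (Q : QueryGraph n) (S : Prog ℕ) (s : Store ℕ)
    (E : Finset (Sym2 (Fin n))) :
    haltProb Q S s (returnsEdgeIn (E : Set (Sym2 (Fin n)))) =
      ∑ e ∈ E, haltProb Q S s (returnsEdge e) := by
  classical
  simp only [haltProb_eq_cost, ← Prog.cost_zero_sum]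
  have hdisj : (E : Set (Sym2 (Fin n))).PairwiseDisjoint returnsEdge :=
    fun e _ e' _ h => disjoint_returnsEdge h
  congr 1
  simp only [returnsEdgeIn, Finset.mem_coe, Finset.indicator_biUnion E returnsEdge hdisj]

theorem haltProb_returnsEdgeIn_add (Q : QueryGraph n) (S : Prog ℕ) (s : Store ℕ)
    {E : Set (Sym2 (Fin n))} (hE : E ⊆ Q.graph.edgeSet) :
    haltProb Q S s (returnsEdgeIn E) + haltProb Q S s (returnsEdgeIn (Q.graph.edgeSet \ E)) =
      haltProb Q S s (returnsSomeEdge Q) := by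
  have hdisj : Disjoint (returnsEdgeIn E) (returnsEdgeIn (Q.graph.edgeSet \ E)) := by
    simp only [returnsEdgeIn, Set.disjoint_iUnion_left, Set.disjoint_iUnion_right]
    rintro e he e' he'
    exact disjoint_returnsEdge fun h => he.2 (h ▸ he')
  rw [← haltProb_union Q S s hdisj, returnsEdgeIn, returnsEdgeIn, ← Set.biUnion_union,
    Set.union_sdiff_cancel hE, returnsSomeEdge_eq, returnsEdgeIn]

end Outcomes

namespace SamplesAlmostUniformly

variable {S : Prog ℕ} {η : ℝ} {n : ℕ} {Q : QueryGraph n} {δ : ℝ} {s : Store ℕ}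
  {E : Set (Sym2 (Fin n))}

theorem haltProb_add_returnsNoEdge (hS : SamplesAlmostUniformly S η) (hm : 0 < Q.numEdges)
    (hδ : 0 < δ) (hδ1 : δ < 1) (hs : SamplerInput n η δ s) :
    haltProb Q S s (returnsSomeEdge Q) + haltProb Q S s returnsNoEdge = 1 := by
  rw [← haltProb_union Q S s (disjoint_returnsSomeEdge_returnsNoEdge Q)]
  exact (hS n Q δ s hm hδ hδ1 hs).1

theorem haltProb_returnsEdgeIn_bounds (hS : SamplesAlmostUniformly S η) (hm : 0 < Q.numEdges)
    (hδ : 0 < δ) (hδ1 : δ < 1) (hs : SamplerInput n η δ s) (hE : E ⊆ Q.graph.edgeSet) :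
    ENNReal.ofReal ((1 - η) * (E.ncard / Q.numEdges)) ≤ haltProb Q S s (returnsEdgeIn E) ∧
      haltProb Q S s (returnsEdgeIn E) ≤ ENNReal.ofReal ((1 + η) * (E.ncard / Q.numEdges)) := by
  have hedge := (hS n Q δ s hm hδ hδ1 hs).2.2
  lift E to Finset (Sym2 (Fin n)) using E.toFinite
  have hconst (a : ℝ) : ENNReal.ofReal (a * ((E : Set (Sym2 (Fin n))).ncard / Q.numEdges)) =
      ∑ _e ∈ E, ENNReal.ofReal (a / Q.numEdges) := by
    rw [Finset.sum_const, Set.ncard_coe_finset, nsmul_eq_mul, ← ENNReal.ofReal_natCast,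
      ← ENNReal.ofReal_mul (by positivity)]
    congr 1
    ring
  rw [haltProb_returnsEdgeIn, hconst, hconst]
  exact ⟨Finset.sum_le_sum fun e he => (hedge e (hE he)).1,
    Finset.sum_le_sum fun e he => (hedge e (hE he)).2⟩

/-- A linear inequality that follows from the guarantees of the sampler holds for its outcomes:
an edge of `E`, an edge outside `E`, or no edge. -/
theorem sum_mul_haltProb_le (hS : SamplesAlmostUniformly S η) (hη : 0 ≤ η)
    (hm : 0 < Q.numEdges) (hδ : 0 < δ) (hδ1 : δ < 1) (hs : SamplerInput n η δ s)
    (hE : E ⊆ Q.graph.edgeSet) {a b c w : ℝ} (ha : 0 ≤ a) (hb : 0 ≤ b) (hc : 0 ≤ c)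
    (h : ∀ p q z : ℝ, 0 ≤ p → 0 ≤ q → 0 ≤ z → p + q + z = 1 → z ≤ δ →
      (1 - η) * (E.ncard / Q.numEdges) ≤ p → p ≤ (1 + η) * (E.ncard / Q.numEdges) →
      a * p + b * q + c * z ≤ w) :
    ENNReal.ofReal a * haltProb Q S s (returnsEdgeIn E) +
      ENNReal.ofReal b * haltProb Q S s (returnsEdgeIn (Q.graph.edgeSet \ E)) +
      ENNReal.ofReal c * haltProb Q S s returnsNoEdge ≤ ENNReal.ofReal w := by
  have hne (A : Set (Store ℕ)) : haltProb Q S s A ≠ ∞ :=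
    ((haltProb_le_one Q S s A).trans_lt ENNReal.one_lt_top).ne
  have hsum := hS.haltProb_add_returnsNoEdge hm hδ hδ1 hs
  have hsome := (hS n Q δ s hm hδ hδ1 hs).2.1
  have hsplit := haltProb_returnsEdgeIn_add Q S s hE
  obtain ⟨hlow, hupp⟩ := hS.haltProb_returnsEdgeIn_bounds hm hδ hδ1 hs hE
  rw [ENNReal.ofReal_le_iff_le_toReal (hne _)] at hsome hlow
  replace hupp := ENNReal.toReal_le_of_le_ofReal (by positivity) hupp
  rw [← hsplit, ENNReal.toReal_add (hne _) (hne _)] at hsome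
  rw [← hsplit, ← ENNReal.toReal_eq_one_iff, ENNReal.toReal_add (by simp [hne]) (hne _),
    ENNReal.toReal_add (hne _) (hne _)] at hsum
  have hofReal (A : Set (Store ℕ)) := (ENNReal.ofReal_toReal (hne A)).symm
  rw [hofReal (returnsEdgeIn E), hofReal (returnsEdgeIn (Q.graph.edgeSet \ E)),
    hofReal returnsNoEdge, ← ENNReal.ofReal_mul ha, ← ENNReal.ofReal_mul hb,
    ← ENNReal.ofReal_mul hc, ← ENNReal.ofReal_add (by positivity) (by positivity),
    ← ENNReal.ofReal_add (by positivity) (by positivity)]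
  exact ENNReal.ofReal_le_ofReal <| h _ _ _ ENNReal.toReal_nonneg ENNReal.toReal_nonneg
    ENNReal.toReal_nonneg hsum (by linarith) hlow hupp

end SamplesAlmostUniformly

/-! ### Estimate-high-edges as a sequence of sampler calls -/

section EstimateHighEdges

/-- The number `r = ⌈100 ⌈log₂ (2/δ)⌉ / ε⌉` of calls of the sampler. -/
def numSamples (ε δ : ℝ) : ℕ := ⌈100 * (numDoublings δ 2 : ℝ) / ε⌉₊

theorem le_numSamples_mul {ε : ℝ} (hε : 0 < ε) (δ : ℝ) :
    100 * (numDoublings δ 2 : ℝ) ≤ numSamples ε δ * ε := by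
  rw [← div_le_iff₀ hε]
  exact Nat.le_ceil _

theorem numSamples_mul_lt {ε : ℝ} (hε : 0 < ε) (δ : ℝ) :
    numSamples ε δ * ε < 100 * (numDoublings δ 2 : ℝ) + ε := by
  have h := Nat.ceil_lt_add_one (show 0 ≤ 100 * (numDoublings δ 2 : ℝ) / ε by positivity)
  rwa [numSamples, ← lt_div_iff₀ hε, add_div, div_self hε.ne']

theorem lt_numSamples_iff {ε : ℝ} (hε : 0 < ε) (δ : ℝ) (j : ℕ) :
    j < numSamples ε δ ↔ j * ε < 100 * (numDoublings δ 2 : ℝ) := by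
  rw [numSamples, Nat.lt_ceil, lt_div_iff₀ hε]

theorem numSamples_pos {ε δ : ℝ} (hε : 0 < ε) (hδ : 0 < δ) (hδ2 : δ < 2) : 0 < numSamples ε δ := by
  have := numDoublings_pos hδ hδ2
  rw [lt_numSamples_iff hε]
  simpa

/-- The part of Estimate-high-edges that computes `⌈log₂ (2/δ)⌉`. -/
def computeLen : List (Prog EheReg) := [
  .op (.const (reg .zero) 0),
  .op (.const (reg .one) 1),
  .op (.const (reg .two) 2),
  .op (.const (reg .len) 0),
  .op (.copy (reg .tmp) (reg .δ)),
  .loop (reg .tmp) (reg .two) (.block [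
    .op (.mul (reg .tmp) (reg .tmp) (reg .two)),
    .op (.add (reg .len) (reg .len) (reg .one))])]

/-- The part of Estimate-high-edges that computes the number of calls of the sampler. -/
def computeNumSamples : List (Prog EheReg) := [
  .op (.const (reg .tmp) 100),
  .op (.mul (reg .len) (reg .len) (reg .tmp)),
  .op (.const (reg .r) 0),
  .op (.const (reg .tmp) 0),
  .loop (reg .tmp) (reg .len) (.block [
    .op (.add (reg .r) (reg .r) (reg .one)),
    .op (.mul (reg .tmp) (reg .r) (reg .ε))])]

/-- The part of Estimate-high-edges that computes `δ'` and the degree threshold and resets the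
counters. -/
def computeThreshold : List (Prog EheReg) := [
  .op (.mul (reg .tmp) (reg .two) (reg .r)),
  .op (.div (reg .δ') (reg .δ) (reg .tmp)),
  .op (.mul (reg .tmp) (reg .two) (reg .α)),
  .op (.div (reg .thr) (reg .tmp) (reg .ε)),
  .op (.const (reg .count) 0),
  .op (.const (reg .failed) 0),
  .op (.const (reg .i) 0)]

/-- The part of Estimate-high-edges that evaluates the outcome of a call of the sampler. -/
def recordSample : Prog EheReg :=
  .ite (sreg 3) (reg .one)
    (.block [
      .op (.const (reg .failed) 1),
      .op (.copy (reg .i) (reg .r))])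
    (.block [
      .op (.degree (reg .degU) (sreg 3)),
      .op (.degree (reg .degV) (sreg 4)),
      .ite (reg .thr) (reg .degU)
        (.ite (reg .thr) (reg .degV)
          (.op (.add (reg .count) (reg .count) (reg .one)))
          .skip)
        .skip])

/-- The loop of Estimate-high-edges that calls the sampler `S`. -/
def sampleLoop (S : Prog ℕ) : Prog EheReg :=
  .loop (reg .i) (reg .r) (.block [
    .op (.add (reg .i) (reg .i) (reg .one)),
    .op (.copy (sreg 0) (reg .n)),
    .op (.const (sreg 1) (1 / 10)),
    .op (.copy (sreg 2) (reg .δ')),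
    S.map Sum.inl,
    recordSample])

/-- The part of Estimate-high-edges that computes the answer. -/
def computeAnswer : Prog EheReg :=
  .ite (reg .zero) (reg .failed)
    (.op (.const (reg .out) 0))
    (.block [
      .op (.div (reg .count) (reg .count) (reg .r)),
      .op (.const (reg .tmp) (26 / 10)),
      .op (.mul (reg .tmp) (reg .tmp) (reg .ε)),
      .ite (reg .tmp) (reg .count)
        (.op (.const (reg .out) 1))
        (.op (.const (reg .out) 0))])

theorem estimateHighEdges_eq (S : Prog ℕ) :
    estimateHighEdges S = .block (computeLen ++ (computeNumSamples ++ (computeThreshold ++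
      [sampleLoop S, computeAnswer]))) :=
  rfl

/-- The registers hold the parameters of Estimate-high-edges and the constants it uses. -/
structure EheConsts (n : ℕ) (α ε δ : ℝ) (σ : Store EheReg) : Prop where
  n : σ (reg .n) = n
  α : σ (reg .α) = α
  ε : σ (reg .ε) = ε
  δ : σ (reg .δ) = δ
  zero : σ (reg .zero) = 0
  one : σ (reg .one) = 1
  two : σ (reg .two) = 2

/-- The state of the sampling loop after `i` of the `r` calls of the sampler, all of which have
returned an edge; `c` of these edges are high. -/
structure EheState (n : ℕ) (ε δ' thr : ℝ) (r i c : ℕ) (σ : Store EheReg) : Prop where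
  n : σ (reg .n) = n
  ε : σ (reg .ε) = ε
  δ' : σ (reg .δ') = δ'
  thr : σ (reg .thr) = thr
  zero : σ (reg .zero) = 0
  one : σ (reg .one) = 1
  r : σ (reg .r) = r
  i : σ (reg .i) = i
  count : σ (reg .count) = c
  failed : σ (reg .failed) = 0

/-- The state of the sampling loop after a call of the sampler that has returned no edge. -/
structure EheFailed (σ : Store EheReg) : Prop where
  zero : σ (reg .zero) = 0
  failed : σ (reg .failed) = 1
  exit : σ (reg .i) = σ (reg .r)

variable {n : ℕ} {α ε δ δ' thr : ℝ} {r i c : ℕ} {σ : Store EheReg}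

theorem runsTo_computeLen (Q : QueryGraph n) (hδ : 0 < δ) (hσ : EheInput n α ε δ σ) :
    RunsTo Q computeLen σ (numDoublings δ 2 * 6 + 12)
      fun σ => EheConsts n α ε δ σ ∧ σ (reg .len) = numDoublings δ 2 := by
  obtain ⟨hn, hα, hε, hδ'⟩ := hσ
  let I (j : ℕ) (σ : Store EheReg) : Prop :=
    EheConsts n α ε δ σ ∧ σ (reg .len) = j ∧ σ (reg .tmp) = δ * 2 ^ j
  refine .op rfl <| .op rfl <| .op rfl <| .op rfl <| .op rfl <|
    .mono (fun σ hσ => ⟨hσ.1, hσ.2.1⟩) <| .loop (I := I) ⟨?_, ?_, ?_⟩ (fun j hj σ hσ => ?_)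
    fun σ hσ => ?_
  · constructor <;> simp [*]
  · simp
  · simp [hδ']
  · obtain ⟨hσ, hlen, htmp⟩ := hσ
    refine ⟨?_, .op rfl <| .op rfl <| .nil ⟨?_, ?_, ?_⟩⟩
    · rw [htmp, hσ.two]
      exact (lt_numDoublings_iff hδ two_pos).1 hj
    · obtain ⟨⟩ := hσ
      constructor <;> simp [*]
    · simp [hlen, hσ.one]
    · simp [htmp, hσ.two, pow_succ, mul_assoc]
  · obtain ⟨hσ, -, htmp⟩ := hσ
    rw [htmp, hσ.two, not_lt]
    exact le_mul_two_pow_numDoublings hδ two_pos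

theorem runsTo_computeNumSamples (Q : QueryGraph n) (hε : 0 < ε) (hσ : EheConsts n α ε δ σ)
    (hlen : σ (reg .len) = numDoublings δ 2) :
    RunsTo Q computeNumSamples σ (numSamples ε δ * 6 + 10)
      fun σ => EheConsts n α ε δ σ ∧ σ (reg .r) = numSamples ε δ := by
  obtain ⟨⟩ := hσ
  let I (j : ℕ) (σ : Store EheReg) : Prop :=
    EheConsts n α ε δ σ ∧ σ (reg .len) = 100 * numDoublings δ 2 ∧ σ (reg .r) = j ∧
      σ (reg .tmp) = j * ε
  refine .op rfl <| .op rfl <| .op rfl <| .op rfl <|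
    .mono (fun σ hσ => ⟨hσ.1, hσ.2.2.1⟩) <| .loop (I := I) ⟨?_, ?_, ?_, ?_⟩ (fun j hj σ hσ => ?_)
    fun σ hσ => ?_
  · constructor <;> simp [*]
  · simp [hlen, mul_comm]
  · simp
  · simp
  · obtain ⟨hσ, hlen, hr, htmp⟩ := hσ
    refine ⟨?_, .op rfl <| .op rfl <| .nil ⟨?_, ?_, ?_, ?_⟩⟩
    · rw [htmp, hlen]
      exact (lt_numSamples_iff hε δ j).1 hj
    · obtain ⟨⟩ := hσ
      constructor <;> simp [*]
    · simp [hlen]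
    · simp [hr, hσ.one]
    · simp [hr, hσ.one, hσ.ε]
  · obtain ⟨-, hlen, -, htmp⟩ := hσ
    rw [htmp, hlen, not_lt]
    exact le_numSamples_mul hε δ

theorem runsTo_computeThreshold (Q : QueryGraph n) (hσ : EheConsts n α ε δ σ)
    (hr : σ (reg .r) = r) :
    RunsTo Q computeThreshold σ 14 (EheState n ε (δ / (2 * r)) (2 * α / ε) r 0 0) := by
  obtain ⟨⟩ := hσ
  refine .op rfl <| .op rfl <| .op rfl <| .op rfl <| .op rfl <| .op rfl <| .op rfl <| .nil ?_
  constructor <;> simp [*]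

theorem exists_cost_estimateHighEdges_eq (Q : QueryGraph n) (S : Prog ℕ) (hε : 0 < ε) (hδ : 0 < δ)
    (hσ : EheInput n α ε δ σ) :
    ∃ σ', EheState n ε (δ / (2 * numSamples ε δ)) (2 * α / ε) (numSamples ε δ) 0 0 σ' ∧
      ∀ τ f, (estimateHighEdges S).cost Q τ f σ =
        (numDoublings δ 2 * 6 + numSamples ε δ * 6 + 37) * τ +
          (sampleLoop S).cost Q τ ((Prog.block [computeAnswer]).cost Q τ f) σ' := by
  obtain ⟨σ', hσ', hcost⟩ := (runsTo_computeLen Q hδ hσ).append fun σ hσ =>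
    (runsTo_computeNumSamples Q hε hσ.1 hσ.2).append fun σ hσ =>
      runsTo_computeThreshold Q hσ.1 hσ.2
  refine ⟨σ', hσ', fun τ f => ?_⟩
  rw [estimateHighEdges_eq, ← List.append_assoc computeNumSamples, ← List.append_assoc, hcost,
    Prog.cost_block_cons]
  push_cast
  ring

theorem EheState.exists_cost_sampleLoop_eq (hσ : EheState n ε δ' thr r i c σ) (hi : i < r)
    (Q : QueryGraph n) (S : Prog ℕ) :
    ∃ (s : Store ℕ) (v : Store Var), SamplerInput n (1 / 10) δ' s ∧
      (∀ s', EheState n ε δ' thr r (i + 1) c (Sum.elim s' v)) ∧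
      ∀ τ f, (sampleLoop S).cost Q τ f σ = 10 * τ + S.cost Q τ (fun s' =>
        (Prog.block [recordSample]).cost Q τ ((sampleLoop S).cost Q τ f) (Sum.elim s' v)) s := by
  have hlt : σ (reg .i) < σ (reg .r) := by
    rw [hσ.i, hσ.r]
    exact_mod_cast hi
  obtain ⟨hn, hε, hδ', hthr, hz, ho, hr, hi, hc, hf⟩ := hσ
  obtain ⟨σ', ⟨hinput, hstate⟩, hcost⟩ : RunsTo Q [
      .op (.add (reg .i) (reg .i) (reg .one)),
      .op (.copy (sreg 0) (reg .n)),
      .op (.const (sreg 1) (1 / 10)),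
      .op (.copy (sreg 2) (reg .δ'))] σ 8 (fun σ => SamplerInput n (1 / 10) δ' (σ ∘ Sum.inl) ∧
        ∀ s, EheState n ε δ' thr r (i + 1) c (Sum.elim s (σ ∘ Sum.inr))) := by
    refine .op rfl <| .op rfl <| .op rfl <| .op rfl <| .nil ⟨?_, fun s => ?_⟩
    · simp [SamplerInput, *]
    · constructor <;> simp [*]
  refine ⟨σ' ∘ Sum.inl, σ' ∘ Sum.inr, hinput, hstate, fun τ f => ?_⟩
  have hbody := hcost [S.map Sum.inl, recordSample] τ ((sampleLoop S).cost Q τ f)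
  rw [Prog.cost_block_cons _ _ _ (S.map Sum.inl), Prog.cost_map_inl] at hbody
  rw [sampleLoop, Prog.cost_loop_pos _ _ _ hlt, ← sampleLoop]
  refine (congrArg (τ + ·) hbody).trans ?_
  push_cast
  ring

theorem EheState.runsTo_recordSample_noEdge (hσ : EheState n ε δ' thr r i c σ) (Q : QueryGraph n)
    (hno : σ (sreg 3) < 1) : ∃ T ≤ 20, RunsTo Q [recordSample] σ T EheFailed := by
  rw [← hσ.one] at hno
  refine ⟨_, ?_, .ite_pos hno <| .block <| .op rfl <| .op rfl <| .nil ?_⟩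
  · norm_num
  · constructor <;> simp [hσ.zero]

open Classical in
theorem EheState.runsTo_recordSample_edge (hσ : EheState n ε δ' thr r i c σ) (Q : QueryGraph n)
    (hedge : 1 ≤ σ (sreg 3)) :
    ∃ T ≤ 20, RunsTo Q [recordSample] σ T (EheState n ε δ' thr r i
      (if thr < Q.degAnswer (σ (sreg 3)) ∧ thr < Q.degAnswer (σ (sreg 4)) then c + 1 else c)) := by
  rw [← hσ.one, ← not_lt] at hedge
  obtain ⟨hn, hε, hδ', hthr, hz, ho, hr, hi, hc, hf⟩ := hσ
  by_cases hU : thr < Q.degAnswer (σ (sreg 3))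
  · by_cases hV : thr < Q.degAnswer (σ (sreg 4))
    · refine ⟨_, ?_, .ite_neg hedge <| .block <| .op rfl <| .op rfl <| .ite_pos ?_ <| .ite_pos ?_ <|
        .op rfl <| .nil ?_⟩
      · norm_num
      · simpa [hthr] using hU
      · simpa [hthr] using hV
      · constructor <;> simp [*]
    · refine ⟨_, ?_, .ite_neg hedge <| .block <| .op rfl <| .op rfl <| .ite_pos ?_ <| .ite_neg ?_ <|
        .skip <| .nil ?_⟩
      · norm_num
      · simpa [hthr] using hU
      · simpa [hthr] using hV
      · constructor <;> simp [*]
  · refine ⟨_, ?_, .ite_neg hedge <| .block <| .op rfl <| .op rfl <| .ite_neg ?_ <| .skip <|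
      .nil ?_⟩
    · norm_num
    · simpa [hthr] using hU
    · constructor <;> simp [*]

theorem EheFailed.runsTo_computeAnswer (hσ : EheFailed σ) (Q : QueryGraph n) :
    RunsTo Q [computeAnswer] σ 3 fun σ => σ (reg .out) = 0 :=
  .ite_pos (by simp [hσ.zero, hσ.failed]) <| .op rfl <| .nil (by simp)

theorem EheState.runsTo_computeAnswer (hσ : EheState n ε δ' thr r r c σ) (Q : QueryGraph n) :
    RunsTo Q [computeAnswer] σ 12 fun σ =>
      σ (reg .out) = if 26 / 10 * ε < c / r then 1 else 0 := by
  refine .ite_neg (by simp [hσ.zero, hσ.failed]) <| .block <| .op rfl <| .op rfl <| .op rfl ?_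
  split_ifs with h
  · refine .ite_pos ?_ <| .op rfl <| .nil (by simp)
    simpa [hσ.ε, hσ.count, hσ.r] using h
  · refine .ite_neg ?_ <| .op rfl <| .nil (by simp)
    simpa [hσ.ε, hσ.count, hσ.r] using h

end EstimateHighEdges

/-! ### Probability of a wrong answer -/

/-- The edges both of whose endpoints have degree above `thr`. -/
def QueryGraph.highEdges {n : ℕ} (Q : QueryGraph n) (thr : ℝ) : Set (Sym2 (Fin n)) :=
  {e ∈ Q.graph.edgeSet | ∀ v ∈ e, thr < (Q.deg v : ℝ)}

theorem QueryGraph.highEdges_subset {n : ℕ} (Q : QueryGraph n) (thr : ℝ) :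
    Q.highEdges thr ⊆ Q.graph.edgeSet :=
  Set.sep_subset _ _

theorem QueryGraph.ncard_highEdges {n : ℕ} (Q : QueryGraph n) (α ε : ℝ) :
    (Q.highEdges (2 * α / ε)).ncard = Q.numHighEdges α ε :=
  rfl

section Potential

variable {n : ℕ} {Q : QueryGraph n} {S : Prog ℕ} {α ε δ δ' thr : ℝ} {r i c : ℕ}
  {σ : Store EheReg} {g : Store EheReg → ℝ≥0∞} {φ : ℝ≥0∞}

theorem EheFailed.cost_sampleLoop (hσ : EheFailed σ) (Q : QueryGraph n) (S : Prog ℕ) (τ : ℝ≥0∞)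
    (g : Store EheReg → ℝ≥0∞) : (sampleLoop S).cost Q τ g σ = τ + g σ :=
  Prog.cost_loop_neg Q τ g (by simp [hσ.exit])

theorem EheState.cost_sampleLoop_exit (hσ : EheState n ε δ' thr r r c σ) (Q : QueryGraph n)
    (S : Prog ℕ) (τ : ℝ≥0∞) (g : Store EheReg → ℝ≥0∞) :
    (sampleLoop S).cost Q τ g σ = τ + g σ :=
  Prog.cost_loop_neg Q τ g (by simp [hσ.i, hσ.r])

theorem EheState.indicator_le_cost_recordSample_add {s : Store ℕ} {v : Store Var} {Ψ : ℕ → ℝ≥0∞}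
    (hσ : EheState n ε δ' thr r i c (Sum.elim s v)) (hfail : ∀ σ, EheFailed σ → 1 ≤ g σ + φ)
    (hstate : ∀ c σ, EheState n ε δ' thr r i c σ → 1 ≤ g σ + Ψ c) :
    (returnsSomeEdge Q ∪ returnsNoEdge).indicator 1 s ≤
      (Prog.block [recordSample]).cost Q 0 g (Sum.elim s v) +
        (Ψ (c + 1) * (returnsEdgeIn (Q.highEdges thr)).indicator 1 s +
          Ψ c * (returnsEdgeIn (Q.graph.edgeSet \ Q.highEdges thr)).indicator 1 s +
          φ * returnsNoEdge.indicator 1 s) := by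
  by_cases hs : s ∈ returnsSomeEdge Q ∪ returnsNoEdge
  swap
  · simp [hs]
  rw [Set.indicator_of_mem hs, Pi.one_apply]
  rcases hs with ⟨e, he, u, w, rfl, hu, hw⟩ | hno
  · obtain ⟨T, -, hrun⟩ := hσ.runsTo_recordSample_edge Q (by simpa [hu] using one_le_vertexLabel u)
    obtain ⟨σ', hσ', hcost⟩ := hrun.exists_cost_block_eq
    simp only [Sum.elim_inl, hu, hw, Q.degAnswer_vertexLabel] at hσ'
    rw [hcost, mul_zero, zero_add]
    refine (hstate _ σ' hσ').trans (add_le_add_right ?_ _)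
    have hret : s ∈ returnsEdge s(u, w) := ⟨u, w, rfl, hu, hw⟩
    by_cases hh : thr < Q.deg u ∧ thr < Q.deg w
    · have hmem : s ∈ returnsEdgeIn (Q.highEdges thr) :=
        Set.mem_biUnion (x := s(u, w)) ⟨he, by simpa using hh⟩ hret
      simp [hh, hmem, add_assoc]
    · have hmem : s ∈ returnsEdgeIn (Q.graph.edgeSet \ Q.highEdges thr) :=
        Set.mem_biUnion (x := s(u, w)) ⟨he, fun h => hh (by simpa using h.2)⟩ hret
      simpa [hh, hmem] using le_add_right le_add_self
  · have hlt : s 3 < 1 := by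
      rw [show s 3 = 0 from hno]
      exact one_pos
    obtain ⟨T, -, hrun⟩ := hσ.runsTo_recordSample_noEdge Q hlt
    obtain ⟨σ', hσ', hcost⟩ := hrun.exists_cost_block_eq
    rw [hcost, mul_zero, zero_add]
    refine (hfail σ' hσ').trans (add_le_add_right ?_ _)
    simp [hno]

/-- The method of conditional expectations: `Φ j c` bounds the probability of a wrong answer when
`j` calls are left and `c` high edges have been found, and `φ` bounds it once a call has failed. -/
theorem EheState.one_le_cost_sampleLoop_add {Φ : ℕ → ℕ → ℝ≥0∞}
    (hfail : ∀ σ, EheFailed σ → 1 ≤ g σ + φ)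
    (hexit : ∀ c σ, EheState n ε δ' thr r r c σ → 1 ≤ g σ + Φ 0 c)
    (hhalt : ∀ s, SamplerInput n (1 / 10) δ' s →
      haltProb Q S s (returnsSomeEdge Q ∪ returnsNoEdge) = 1)
    (hstep : ∀ j c s, SamplerInput n (1 / 10) δ' s →
      Φ j (c + 1) * haltProb Q S s (returnsEdgeIn (Q.highEdges thr)) +
        Φ j c * haltProb Q S s (returnsEdgeIn (Q.graph.edgeSet \ Q.highEdges thr)) +
        φ * haltProb Q S s returnsNoEdge ≤ Φ (j + 1) c)
    (j : ℕ) (hij : i + j = r) (hσ : EheState n ε δ' thr r i c σ) :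
    1 ≤ (sampleLoop S).cost Q 0 g σ + Φ j c := by
  induction j generalizing i c σ with
  | zero =>
    obtain rfl : i = r := hij
    rw [hσ.cost_sampleLoop_exit, zero_add]
    exact hexit c σ hσ
  | succ j ih =>
    obtain ⟨s, v, hs, hstate, hcost⟩ := hσ.exists_cost_sampleLoop_eq (by omega) Q S
    rw [hcost, mul_zero, zero_add, ← hhalt s hs]
    refine le_trans ?_ (add_le_add_right (hstep j c s hs) _)
    simp only [haltProb_eq_cost, ← Prog.cost_zero_const_mul, ← Prog.cost_zero_add]
    refine Prog.cost_mono Q 0 (fun s' => ?_) S s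
    refine (hstate s').indicator_le_cost_recordSample_add (fun σ hσ => ?_)
      fun c σ hσ => ih (by omega) hσ
    rw [hσ.cost_sampleLoop, zero_add]
    exact hfail σ hσ

theorem one_le_haltProb_estimateHighEdges_add {A : Set (Store EheReg)} {Φ : ℕ → ℕ → ℝ≥0∞}
    (hε : 0 < ε) (hδ : 0 < δ) (hσ : EheInput n α ε δ σ)
    (hfail : ∀ σ : Store EheReg, σ (reg .out) = 0 → 1 ≤ A.indicator 1 σ + φ)
    (hexit : ∀ (c : ℕ) (σ : Store EheReg),
      (σ (reg .out) = if 26 / 10 * ε < c / numSamples ε δ then 1 else 0) →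
      1 ≤ A.indicator 1 σ + Φ 0 c)
    (hhalt : ∀ s, SamplerInput n (1 / 10) (δ / (2 * numSamples ε δ)) s →
      haltProb Q S s (returnsSomeEdge Q ∪ returnsNoEdge) = 1)
    (hstep : ∀ j c s, SamplerInput n (1 / 10) (δ / (2 * numSamples ε δ)) s →
      Φ j (c + 1) * haltProb Q S s (returnsEdgeIn (Q.highEdges (2 * α / ε))) +
        Φ j c * haltProb Q S s (returnsEdgeIn (Q.graph.edgeSet \ Q.highEdges (2 * α / ε))) +
        φ * haltProb Q S s returnsNoEdge ≤ Φ (j + 1) c) :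
    1 ≤ haltProb Q (estimateHighEdges S) σ A + Φ (numSamples ε δ) 0 := by
  obtain ⟨σ', hσ', hcost⟩ := exists_cost_estimateHighEdges_eq Q S hε hδ hσ
  rw [haltProb_eq_cost, hcost, mul_zero, zero_add]
  refine hσ'.one_le_cost_sampleLoop_add (fun σ hσ => ?_) (fun c σ hσ => ?_) hhalt hstep _
    (zero_add _)
  · obtain ⟨σ', hout, hcost⟩ := (hσ.runsTo_computeAnswer Q).exists_cost_block_eq
    rw [hcost, mul_zero, zero_add]
    exact hfail σ' hout
  · obtain ⟨σ', hout, hcost⟩ := (hσ.runsTo_computeAnswer Q).exists_cost_block_eq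
    rw [hcost, mul_zero, zero_add]
    exact hexit c σ' hout

theorem EheState.cost_recordSample_le (hσ : EheState n ε δ' thr r i c σ) {G : ℝ≥0∞}
    (hfail : ∀ σ, EheFailed σ → g σ ≤ G)
    (hstate : ∀ c σ, EheState n ε δ' thr r i c σ → g σ ≤ G) :
    (Prog.block [recordSample]).cost Q 1 g σ ≤ 21 + G := by
  have hle {T : ℕ} (hT : T ≤ 20) : ((T : ℝ≥0∞) + 1) * 1 ≤ 21 := by
    rw [mul_one]
    exact_mod_cast Nat.succ_le_succ hT
  rcases lt_or_ge (σ (sreg 3)) 1 with hno | hedge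
  · obtain ⟨T, hT, hrun⟩ := hσ.runsTo_recordSample_noEdge Q hno
    obtain ⟨σ', hσ', hcost⟩ := hrun.exists_cost_block_eq
    exact (hcost 1 g).trans_le (add_le_add (hle hT) (hfail σ' hσ'))
  · obtain ⟨T, hT, hrun⟩ := hσ.runsTo_recordSample_edge Q hedge
    obtain ⟨σ', hσ', hcost⟩ := hrun.exists_cost_block_eq
    exact (hcost 1 g).trans_le (add_le_add (hle hT) (hstate _ σ' hσ'))

theorem EheState.cost_sampleLoop_le {B G : ℝ≥0∞} (hG : ∀ σ, g σ ≤ G)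
    (hB : ∀ s, SamplerInput n (1 / 10) δ' s → S.cost Q 1 (fun _ => 0) s ≤ B)
    (j : ℕ) (hij : i + j = r) (hσ : EheState n ε δ' thr r i c σ) :
    (sampleLoop S).cost Q 1 g σ ≤ j * (31 + B) + (1 + G) := by
  induction j generalizing i c σ with
  | zero =>
    obtain rfl : i = r := hij
    rw [hσ.cost_sampleLoop_exit]
    exact (add_le_add_right (hG σ) 1).trans le_add_self
  | succ j ih =>
    obtain ⟨s, v, hs, hstate, hcost⟩ := hσ.exists_cost_sampleLoop_eq (by omega) Q S
    have hrecord (s' : Store ℕ) : (Prog.block [recordSample]).cost Q 1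
        ((sampleLoop S).cost Q 1 g) (Sum.elim s' v) ≤ 21 + (j * (31 + B) + (1 + G)) := by
      refine (hstate s').cost_recordSample_le (fun σ hσ => ?_) fun c σ hσ => ih (by omega) hσ
      rw [hσ.cost_sampleLoop]
      exact (add_le_add_right (hG σ) 1).trans le_add_self
    rw [hcost, Prog.cost_eq_time_add]
    calc _ ≤ 10 * 1 + (B + (21 + (j * (31 + B) + (1 + G)))) := by
          gcongr
          · exact hB s hs
          · exact Prog.cost_zero_le Q hrecord S s
      _ = _ := by push_cast; ring

theorem cost_computeAnswer_le (Q : QueryGraph n) (σ : Store EheReg) :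
    (Prog.block [computeAnswer]).cost Q 1 (fun _ => 0) σ ≤ 30 := by
  refine (Prog.time_le_maxTime Q _ σ).trans ?_
  norm_num [computeAnswer, Prog.block, Prog.maxTime]

theorem expectedTime_estimateHighEdges_le (hε : 0 < ε) (hδ : 0 < δ) (hσ : EheInput n α ε δ σ)
    {B : ℝ≥0∞}
    (hB : ∀ s, SamplerInput n (1 / 10) (δ / (2 * numSamples ε δ)) s → expectedTime Q S s ≤ B) :
    expectedTime Q (estimateHighEdges S) σ ≤
      numDoublings δ 2 * 6 + numSamples ε δ * (37 + B) + 68 := by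
  obtain ⟨σ', hσ', hcost⟩ := exists_cost_estimateHighEdges_eq Q S hε hδ hσ
  simp only [expectedTime_eq_cost] at hB ⊢
  rw [hcost]
  refine (add_le_add_right (hσ'.cost_sampleLoop_le (cost_computeAnswer_le Q) hB _
    (zero_add _)) _).trans_eq ?_
  ring

end Potential

section Potentials

variable {ε δ δ' p q z : ℝ} {r j c : ℕ}

/-- An upper bound for the probability that the answer will be FEW, when many edges are high, `j` of
the `r` calls are still to be made, and `c` high edges have been found. -/
def manyPotential (ε δ' : ℝ) (r j c : ℕ) : ℝ :=
  j * δ' + Real.exp (Real.log (10 / 9) * (26 / 10 * ε * r - c) - 36 / 100 * ε * j)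

/-- An upper bound for the probability that the answer will be MANY, when few edges are high, `j` of
the `r` calls are still to be made, and `c` high edges have been found. -/
def fewPotential (ε : ℝ) (r j c : ℕ) : ℝ :=
  Real.exp (Real.log (11 / 10) * (c - 26 / 10 * ε * r) + 22 / 100 * ε * j)

theorem one_le_manyPotential_zero (hr : 0 < r) (h : c / r ≤ 26 / 10 * ε) :
    1 ≤ manyPotential ε δ' r 0 c := by
  have hlog : 0 ≤ Real.log (10 / 9) := Real.log_nonneg (by norm_num)
  have hc : 0 ≤ 26 / 10 * ε * r - c := sub_nonneg.2 ((div_le_iff₀ (by positivity)).1 h)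
  simpa [manyPotential] using mul_nonneg hlog hc

theorem one_le_fewPotential_zero (hr : 0 < r) (h : 26 / 10 * ε < c / r) :
    1 ≤ fewPotential ε r 0 c := by
  have hlog : 0 ≤ Real.log (11 / 10) := Real.log_nonneg (by norm_num)
  have hc : 0 ≤ c - 26 / 10 * ε * r := sub_nonneg.2 ((lt_div_iff₀ (by positivity)).1 h).le
  simpa [fewPotential] using mul_nonneg hlog hc

theorem manyPotential_step (hδ' : 0 ≤ δ') (hp : 36 / 10 * ε ≤ p) (hz : 0 ≤ z)
    (hsum : p + q + z = 1) (hzδ : z ≤ δ') :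
    manyPotential ε δ' r j (c + 1) * p + manyPotential ε δ' r j c * q + 1 * z ≤
      manyPotential ε δ' r (j + 1) c := by
  set x := Real.exp (Real.log (10 / 9) * (26 / 10 * ε * r - c) - 36 / 100 * ε * j) with hx
  have hfound : manyPotential ε δ' r j (c + 1) = j * δ' + 9 / 10 * x := by
    have hexp : Real.exp (-Real.log (10 / 9)) = 9 / 10 := by
      rw [Real.exp_neg, Real.exp_log (by norm_num), inv_div]
    rw [manyPotential, hx, ← hexp, ← Real.exp_add]
    push_cast
    ring_nf
  have hnext : manyPotential ε δ' r (j + 1) c =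
      (j + 1) * δ' + Real.exp (-(36 / 100 * ε)) * x := by
    rw [manyPotential, hx, ← Real.exp_add]
    push_cast
    ring_nf
  have hmean : 9 / 10 * p + q ≤ Real.exp (-(36 / 100 * ε)) := by
    linarith [Real.one_sub_le_exp_neg (36 / 100 * ε)]
  calc manyPotential ε δ' r j (c + 1) * p + manyPotential ε δ' r j c * q + 1 * z
      = (1 - z) * (j * δ') + (9 / 10 * p + q) * x + z := by
        rw [hfound, manyPotential, ← hx, ← eq_sub_of_add_eq hsum]
        ring
    _ ≤ 1 * (j * δ') + Real.exp (-(36 / 100 * ε)) * x + δ' := by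
        gcongr
        linarith
    _ = manyPotential ε δ' r (j + 1) c := by
        rw [hnext]
        ring

theorem fewPotential_step (hp : p ≤ 22 / 10 * ε) (hz : 0 ≤ z) (hsum : p + q + z = 1) :
    fewPotential ε r j (c + 1) * p + fewPotential ε r j c * q ≤ fewPotential ε r (j + 1) c := by
  have hfound : fewPotential ε r j (c + 1) = 11 / 10 * fewPotential ε r j c := by
    have hexp : Real.exp (Real.log (11 / 10)) = 11 / 10 := Real.exp_log (by norm_num)
    rw [fewPotential, fewPotential, ← hexp, ← Real.exp_add, hexp]
    push_cast
    ring_nf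
  have hnext : fewPotential ε r (j + 1) c = Real.exp (22 / 100 * ε) * fewPotential ε r j c := by
    rw [fewPotential, fewPotential, ← Real.exp_add]
    push_cast
    ring_nf
  have hmean : 11 / 10 * p + q ≤ Real.exp (22 / 100 * ε) := by
    linarith [Real.add_one_le_exp (22 / 100 * ε)]
  calc fewPotential ε r j (c + 1) * p + fewPotential ε r j c * q
      = (11 / 10 * p + q) * fewPotential ε r j c := by
        rw [hfound]
        ring
    _ ≤ fewPotential ε r (j + 1) c := by
        rw [hnext]
        exact mul_le_mul_of_nonneg_right hmean (Real.exp_pos _).le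

theorem exp_neg_le_half_of_numSamples_mul_le (hε : 0 < ε) (hδ : 0 < δ) {t : ℝ}
    (h : 1 / 100 * (numSamples ε δ * ε) ≤ t) : Real.exp (-t) ≤ δ / 2 := by
  refine exp_neg_le_div_of_numDoublings_le hδ two_pos (le_trans ?_ h)
  have hlog : Real.log 2 ≤ 1 := by linarith [Real.log_two_lt_d9]
  have := mul_le_of_le_one_right (numDoublings δ 2).cast_nonneg hlog
  linarith [le_numSamples_mul hε δ]

theorem manyPotential_numSamples_le (hε : 0 < ε) (hδ : 0 < δ) :
    manyPotential ε (δ / (2 * numSamples ε δ)) (numSamples ε δ) (numSamples ε δ) 0 ≤ δ := by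
  set r := numSamples ε δ with hr
  have hlog : Real.log (10 / 9) ≤ 1 / 9 :=
    (Real.log_le_sub_one_of_pos (by norm_num)).trans (by norm_num)
  have hexp : Real.exp (-(36 / 100 * (r * ε) - Real.log (10 / 9) * (26 / 10 * (r * ε)))) ≤
      δ / 2 := by
    refine exp_neg_le_half_of_numSamples_mul_le hε hδ ?_
    rw [← hr]
    nlinarith [mul_nonneg r.cast_nonneg hε.le]
  have hfail : r * (δ / (2 * r)) ≤ δ / 2 :=
    calc r * (δ / (2 * r)) = δ / 2 * (r / r) := by ring
      _ ≤ δ / 2 := mul_le_of_le_one_right (by positivity) (div_self_le_one _)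
  calc manyPotential ε (δ / (2 * r)) r r 0
      = r * (δ / (2 * r)) +
          Real.exp (-(36 / 100 * (r * ε) - Real.log (10 / 9) * (26 / 10 * (r * ε)))) := by
        rw [manyPotential]
        push_cast
        ring_nf
    _ ≤ δ := by linarith

theorem fewPotential_numSamples_le (hε : 0 < ε) (hδ : 0 < δ) :
    fewPotential ε (numSamples ε δ) (numSamples ε δ) 0 ≤ δ / 2 := by
  set r := numSamples ε δ with hr
  have hlog : 1 / 11 ≤ Real.log (11 / 10) := by
    linarith [Real.one_sub_inv_le_log_of_pos (show (0 : ℝ) < 11 / 10 by norm_num)]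
  have hexp : Real.exp (-(Real.log (11 / 10) * (26 / 10 * (r * ε)) - 22 / 100 * (r * ε))) ≤
      δ / 2 := by
    refine exp_neg_le_half_of_numSamples_mul_le hε hδ ?_
    rw [← hr]
    nlinarith [mul_nonneg r.cast_nonneg hε.le]
  refine le_of_eq_of_le ?_ hexp
  rw [fewPotential]
  push_cast
  ring_nf

end Potentials

section Correctness

variable {n : ℕ} {Q : QueryGraph n} {S : Prog ℕ} {α ε δ : ℝ} {σ : Store EheReg}

theorem ofReal_one_sub_le {p : ℝ≥0∞} {a : ℝ} (h : 1 ≤ p + ENNReal.ofReal a) (ha : a ≤ δ)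
    (hδ : 0 ≤ δ) : ENNReal.ofReal (1 - δ) ≤ p := by
  rw [ENNReal.ofReal_sub _ hδ, ENNReal.ofReal_one, tsub_le_iff_right]
  exact h.trans (by gcongr)

theorem failureParam_mem_Ioo (hε : 0 < ε) (hδ : 0 < δ) (hδ1 : δ < 1) :
    0 < δ / (2 * numSamples ε δ) ∧ δ / (2 * numSamples ε δ) < 1 := by
  have hr : (1 : ℝ) ≤ numSamples ε δ := by
    exact_mod_cast numSamples_pos hε hδ (by linarith)
  exact ⟨by positivity, (div_lt_one (by positivity)).2 (by linarith)⟩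

theorem haltProb_estimateHighEdges_answers (hS : SamplesAlmostUniformly S (1 / 10))
    (hm : 0 < Q.numEdges) (hε : 0 < ε) (hδ : 0 < δ) (hδ1 : δ < 1) (hσ : EheInput n α ε δ σ) :
    haltProb Q (estimateHighEdges S) σ (answersMany ∪ answersFew) = 1 := by
  obtain ⟨hδ', hδ'1⟩ := failureParam_mem_Ioo hε hδ hδ1
  refine le_antisymm (haltProb_le_one Q _ σ _) ?_
  have h := one_le_haltProb_estimateHighEdges_add (A := answersMany ∪ answersFew)
    (Φ := fun _ _ => 0) (φ := 0) hε hδ hσ (fun σ hout => ?_) (fun c σ hout => ?_)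
    (fun s hs => (hS n Q _ s hm hδ' hδ'1 hs).1) (fun _ _ s _ => by simp)
  · rwa [add_zero] at h
  · rw [Set.indicator_of_mem (show σ ∈ answersMany ∪ answersFew from Or.inr hout)]
    exact le_self_add
  · have hmem : σ ∈ answersMany ∪ answersFew := by
      split_ifs at hout
      exacts [Or.inl hout, Or.inr hout]
    rw [Set.indicator_of_mem hmem]
    exact le_self_add

theorem ofReal_one_sub_le_haltProb_answersMany (hS : SamplesAlmostUniformly S (1 / 10))
    (hm : 0 < Q.numEdges) (hε : 0 < ε) (hδ : 0 < δ) (hδ1 : δ < 1) (hσ : EheInput n α ε δ σ)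
    (hmany : 4 * ε * Q.numEdges < Q.numHighEdges α ε) :
    ENNReal.ofReal (1 - δ) ≤ haltProb Q (estimateHighEdges S) σ answersMany := by
  obtain ⟨hδ', hδ'1⟩ := failureParam_mem_Ioo hε hδ hδ1
  have hfrac : 4 * ε < (Q.highEdges (2 * α / ε)).ncard / Q.numEdges := by
    rwa [lt_div_iff₀ (by exact_mod_cast hm), Q.ncard_highEdges]
  refine ofReal_one_sub_le ?_ (manyPotential_numSamples_le hε hδ) hδ.le
  refine one_le_haltProb_estimateHighEdges_add (φ := ENNReal.ofReal 1)
    (Φ := fun j c => ENNReal.ofReal (manyPotential ε _ (numSamples ε δ) j c)) hε hδ hσ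
    (fun σ _ => by simp) (fun c σ hout => ?_) (fun s hs => (hS n Q _ s hm hδ' hδ'1 hs).1)
    (fun j c s hs => ?_)
  · split_ifs at hout with h
    · rw [Set.indicator_of_mem (show σ ∈ answersMany from hout)]
      exact le_self_add
    · exact le_add_left (ENNReal.one_le_ofReal.2
        (one_le_manyPotential_zero (numSamples_pos hε hδ (by linarith)) (not_lt.1 h)))
  · have hnonneg (c : ℕ) : 0 ≤ manyPotential ε (δ / (2 * numSamples ε δ)) (numSamples ε δ) j c := by
      unfold manyPotential
      positivity
    exact hS.sum_mul_haltProb_le (by norm_num) hm hδ' hδ'1 hs (Q.highEdges_subset _)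
      (hnonneg _) (hnonneg _) zero_le_one fun p q z _ _ hz hsum hzδ hlow _ =>
        manyPotential_step hδ'.le (by linarith) hz hsum hzδ

theorem ofReal_one_sub_le_haltProb_answersFew (hS : SamplesAlmostUniformly S (1 / 10))
    (hm : 0 < Q.numEdges) (hε : 0 < ε) (hδ : 0 < δ) (hδ1 : δ < 1) (hσ : EheInput n α ε δ σ)
    (hfew : Q.numHighEdges α ε ≤ 2 * ε * Q.numEdges) :
    ENNReal.ofReal (1 - δ) ≤ haltProb Q (estimateHighEdges S) σ answersFew := by
  obtain ⟨hδ', hδ'1⟩ := failureParam_mem_Ioo hε hδ hδ1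
  have hfrac : (Q.highEdges (2 * α / ε)).ncard / Q.numEdges ≤ 2 * ε := by
    rwa [div_le_iff₀ (by exact_mod_cast hm), Q.ncard_highEdges]
  refine ofReal_one_sub_le ?_ ((fewPotential_numSamples_le hε hδ).trans (by linarith)) hδ.le
  refine one_le_haltProb_estimateHighEdges_add (φ := ENNReal.ofReal 0)
    (Φ := fun j c => ENNReal.ofReal (fewPotential ε (numSamples ε δ) j c)) hε hδ hσ
    (fun σ hout => ?_) (fun c σ hout => ?_) (fun s hs => (hS n Q _ s hm hδ' hδ'1 hs).1)
    (fun j c s hs => ?_)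
  · rw [Set.indicator_of_mem (show σ ∈ answersFew from hout)]
    exact le_self_add
  · split_ifs at hout with h
    · exact le_add_left (ENNReal.one_le_ofReal.2
        (one_le_fewPotential_zero (numSamples_pos hε hδ (by linarith)) h))
    · rw [Set.indicator_of_mem (show σ ∈ answersFew from hout)]
      exact le_self_add
  · refine hS.sum_mul_haltProb_le (by norm_num) hm hδ' hδ'1 hs (Q.highEdges_subset _)
      (Real.exp_pos _).le (Real.exp_pos _).le le_rfl fun p q z _ _ hz hsum _ _ hupp => ?_
    rw [zero_mul, add_zero]
    exact fewPotential_step (by linarith) hz hsum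

end Correctness

/-! ### A trial of the edge sampler -/

section Trial

/-- The part of a trial that returns the edge between the vertices in registers `12` and `15`.
Copying register `9` into register `10` makes this trial the last one. -/
def returnFoundEdge : Prog ℕ :=
  .block [.op (.copy 3 12), .op (.copy 4 15), .op (.copy 10 9)]

/-- The part of a trial that returns a random edge at the vertex in register `15` if this vertex is
heavy. -/
def returnHeavyEdge : Prog ℕ :=
  .block [
    .op (.degree 14 15),
    .ite 11 14
      (.block [
        .op (.rand 13 14),
        .op (.neighbor 16 15 13),
        .op (.copy 3 15),
        .op (.copy 4 16),
        .op (.copy 10 9)])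
      .skip]

/-- The part of a trial that follows the discovery of an edge at a vertex that is not heavy. -/
def samplerFound : Prog ℕ :=
  .block [.op (.const 8 2), .op (.rand 16 8), .ite 5 16 returnHeavyEdge returnFoundEdge]

/-- A trial of the sampler. A vertex is heavy if its degree exceeds the threshold `θ` in register
`11`, which is the content of register `9` divided by the number of the trial. A trial picks a
random vertex `u` and a random number `j ≤ θ`. If `u` is not heavy and has a `j`-th neighbor `w`,
a coin decides whether the trial returns the edge `uw` or, provided that `w` is heavy, a random
edge at `w`. -/
def samplerTrial : Prog ℕ :=
  .block [
    .op (.add 10 10 5),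
    .op (.div 11 9 10),
    .op (.rand 12 0),
    .op (.rand 13 11),
    .op (.degree 14 12),
    .op (.neighbor 15 12 13),
    .ite 11 14 .skip (.ite 15 5 .skip samplerFound)]

/-- The state of the sampler after `k` of at most `A` trials, all of which have failed. -/
structure SamplerState (n : ℕ) (A : ℝ) (k : ℕ) (σ : Store ℕ) : Prop where
  n : σ 0 = n
  one : σ 5 = 1
  total : σ 9 = A
  trials : σ 10 = k
  result : σ 3 = 0

/-- The state of the sampler after a trial that has returned the edge between `a` and `b`. -/
structure SamplerDone {n : ℕ} (A : ℝ) (a b : Fin n) (σ : Store ℕ) : Prop where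
  total : σ 9 = A
  trials : σ 10 = A
  fst : σ 3 = vertexLabel a
  snd : σ 4 = vertexLabel b

variable {n : ℕ} (Q : QueryGraph n) (θ : ℝ) (g : Fin n → Fin n → ℝ≥0∞) (v : ℝ≥0∞)

open Classical in
/-- The expected value of an attempt to return a random edge at `w`; see `trialValue`. -/
def heavyValue (w : Fin n) : ℝ≥0∞ :=
  if θ < Q.deg w then (Q.deg w : ℝ≥0∞)⁻¹ * ∑ j : Fin (Q.deg w), g w (Q.nbr w j) else v

open Classical in
/-- The expected value of a trial that has picked the vertex `u` and the number `j + 1`; see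
`trialValue`. -/
def choiceValue (u : Fin n) (j : ℕ) : ℝ≥0∞ :=
  if θ < Q.deg u then v
  else if h : j < Q.deg u then
    2⁻¹ * (g u (Q.nbr u ⟨j, h⟩) + heavyValue Q θ g v (Q.nbr u ⟨j, h⟩))
  else v

/-- The expected value of a trial with threshold `θ`, where returning the edge `ab`, found at `a`,
is worth `g a b` and a failure is worth `v`. -/
def trialValue : ℝ≥0∞ :=
  (n : ℝ≥0∞)⁻¹ * ∑ u : Fin n, (⌊θ⌋₊ : ℝ≥0∞)⁻¹ * ∑ j : Fin ⌊θ⌋₊, choiceValue Q θ g v u j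

variable {Q θ g v} {A : ℝ} {k : ℕ} {F : Store ℕ → ℝ≥0∞} {σ : Store ℕ}

theorem cost_returnFoundEdge (hg : ∀ a b σ, SamplerDone A a b σ → F σ = g a b) (h9 : σ 9 = A)
    {u w : Fin n} (hu : σ 12 = vertexLabel u) (hw : σ 15 = vertexLabel w) :
    returnFoundEdge.cost Q 0 F σ = g u w := by
  simp only [returnFoundEdge, Prog.cost_block_cons, Prog.cost_block_nil, Prog.cost_op, Instr.eval,
    expectation_pure, zero_add]
  refine hg u w _ ?_
  constructor <;> simp [*]

theorem cost_returnHeavyEdge (hv : ∀ σ, SamplerState n A k σ → F σ = v)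
    (hg : ∀ a b σ, SamplerDone A a b σ → F σ = g a b) (hσ : SamplerState n A k σ) (hθ : 0 ≤ θ)
    (h11 : σ 11 = θ) {w : Fin n} (hw : σ 15 = vertexLabel w) :
    returnHeavyEdge.cost Q 0 F σ = heavyValue Q θ g v w := by
  obtain ⟨⟩ := hσ
  have hdeg : Q.degAnswer (σ 15) = Q.deg w := by rw [hw, Q.degAnswer_vertexLabel]
  simp only [returnHeavyEdge, Prog.cost_block_cons, Prog.cost_op, Instr.eval, expectation_pure,
    zero_add, hdeg]
  by_cases hd : θ < Q.deg w
  · have hpos : 0 < Q.deg w := by exact_mod_cast hθ.trans_lt hd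
    rw [Prog.cost_ite_pos _ _ _ (by simpa [h11] using hd), heavyValue, if_pos hd]
    simp only [Prog.cost_block_cons, Prog.cost_block_nil, Prog.cost_op, Instr.eval,
      expectation_pure, expectation_map, Function.update_self, Nat.floor_natCast, zero_add,
      expectation_uniformUpTo hpos]
    congr! 2 with j
    refine hg w (Q.nbr w j) _ ?_
    constructor <;> simp [*, Q.nbrAnswer_vertexLabel]
  · rw [Prog.cost_ite_neg _ _ _ (by simpa [h11] using hd), heavyValue, if_neg hd]
    simp only [Prog.cost_skip, Prog.cost_block_nil, zero_add]
    refine hv _ ?_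
    constructor <;> simp [*]

theorem cost_samplerFound (hv : ∀ σ, SamplerState n A k σ → F σ = v)
    (hg : ∀ a b σ, SamplerDone A a b σ → F σ = g a b) (hσ : SamplerState n A k σ) (hθ : 0 ≤ θ)
    (h11 : σ 11 = θ) {u w : Fin n} (hu : σ 12 = vertexLabel u) (hw : σ 15 = vertexLabel w) :
    samplerFound.cost Q 0 F σ = 2⁻¹ * (g u w + heavyValue Q θ g v w) := by
  have h5 := hσ.one
  simp only [samplerFound, Prog.cost_block_cons, Prog.cost_op, Instr.eval, expectation_pure,
    expectation_map, Function.update_self, Rat.cast_ofNat, Nat.floor_ofNat, zero_add,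
    Prog.cost_zero_block_nil, expectation_uniformUpTo two_pos, Fin.sum_univ_two]
  congr 2
  · rw [Prog.cost_ite_neg _ _ _ (by simp [h5]), zero_add]
    exact cost_returnFoundEdge hg (by simp [hσ.total]) (by simp [hu]) (by simp [hw])
  · rw [Prog.cost_ite_pos _ _ _ (by simp [h5]), zero_add]
    refine cost_returnHeavyEdge hv hg ?_ hθ (by simp [h11]) (by simp [hw])
    obtain ⟨⟩ := hσ
    constructor <;> simp [*]

theorem cost_samplerChoice (hv : ∀ σ, SamplerState n A k σ → F σ = v)
    (hg : ∀ a b σ, SamplerDone A a b σ → F σ = g a b) (hσ : SamplerState n A k σ) (hθ : 0 ≤ θ)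
    (h11 : σ 11 = θ) {u : Fin n} {j : ℕ} (hu : σ 12 = vertexLabel u) (h14 : σ 14 = Q.deg u)
    (h15 : σ 15 = Q.nbrAnswer (vertexLabel u) (j + 1)) :
    (Prog.ite 11 14 .skip (.ite 15 5 .skip samplerFound)).cost Q 0 F σ =
      choiceValue Q θ g v u j := by
  unfold choiceValue
  split_ifs with hd hj
  · rw [Prog.cost_ite_pos _ _ _ (by rwa [h11, h14]), Prog.cost_skip, zero_add, zero_add, hv σ hσ]
  · have hw : σ 15 = vertexLabel (Q.nbr u ⟨j, hj⟩ : Fin n) := by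
      rw [h15]
      exact Q.nbrAnswer_vertexLabel u ⟨j, hj⟩
    rw [Prog.cost_ite_neg _ _ _ (by rwa [h11, h14]),
      Prog.cost_ite_neg _ _ _ (by rw [hw, hσ.one]; exact not_lt.2 (one_le_vertexLabel _)),
      cost_samplerFound hv hg hσ hθ h11 hu hw, zero_add, zero_add]
  · have h0 : σ 15 = 0 := by rw [h15, Q.nbrAnswer_of_deg_le u (not_lt.1 hj)]
    rw [Prog.cost_ite_neg _ _ _ (by rwa [h11, h14]),
      Prog.cost_ite_pos _ _ _ (by rw [h0, hσ.one]; exact one_pos), Prog.cost_skip, zero_add,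
      zero_add, zero_add, hv σ hσ]

theorem cost_samplerTrial (hv : ∀ σ, SamplerState n A (k + 1) σ → F σ = v)
    (hg : ∀ a b σ, SamplerDone A a b σ → F σ = g a b) (hσ : SamplerState n A k σ) (hn : 0 < n)
    (hA : 1 ≤ A / (k + 1)) :
    samplerTrial.cost Q 0 F σ = trialValue Q (A / (k + 1)) g v := by
  obtain ⟨h0, h5, h9, h10, h3⟩ := hσ
  simp only [samplerTrial, Prog.cost_block_cons, Prog.cost_op, Instr.eval, expectation_pure,
    expectation_map, zero_add, Prog.cost_zero_block_nil, trialValue]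
  have hfloor0 : ⌊(n : ℝ)⌋₊ = n := Nat.floor_natCast n
  simp only [ne_eq, Nat.reduceEqDiff, not_false_eq_true,
    Function.update_of_ne, Function.update_self, OfNat.zero_ne_ofNat,
    h0, h5, h9, h10, hfloor0, expectation_uniformUpTo hn,
    expectation_uniformUpTo (Nat.floor_pos.2 hA)]
  congr! 4 with u _ j
  refine cost_samplerChoice hv hg ?_ (zero_le_one.trans hA) ?_ ?_ ?_ ?_
  · constructor <;> simp [*]
  · simp
  · simp [vertexLabel]
  · simpa [vertexLabel] using Q.degAnswer_vertexLabel u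
  · simp [vertexLabel]

end Trial

section Trial

variable {n : ℕ} (Q : QueryGraph n) (θ : ℝ) (g : Fin n → Fin n → ℝ≥0∞) (v : ℝ≥0∞)

instance QueryGraph.decidableRelAdj : DecidableRel Q.graph.Adj :=
  Classical.decRel _

theorem QueryGraph.deg_eq_card (u : Fin n) : Q.deg u = (Q.graph.neighborFinset u).card := by
  rw [QueryGraph.deg, Set.ncard_eq_toFinset_card']
  rfl

theorem QueryGraph.sum_nbr (u : Fin n) (φ : Fin n → ℝ≥0∞) :
    ∑ j : Fin (Q.deg u), φ (Q.nbr u j) = ∑ w ∈ Q.graph.neighborFinset u, φ w :=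
  calc ∑ j : Fin (Q.deg u), φ (Q.nbr u j) = ∑ w : Q.graph.neighborSet u, φ w :=
        Fintype.sum_equiv (Q.nbr u) _ _ fun _ => rfl
    _ = _ := (Finset.sum_subtype _ (fun w => by simp) φ).symm

theorem QueryGraph.sum_deg : ∑ u, Q.deg u = 2 * Q.numEdges := by
  simp only [Q.deg_eq_card, SimpleGraph.card_neighborFinset_eq_degree,
    Q.graph.sum_degrees_eq_twice_card_edges, QueryGraph.numEdges, Set.ncard_eq_toFinset_card',
    SimpleGraph.edgeFinset]

theorem QueryGraph.two_mul_numEdges_le : 2 * Q.numEdges ≤ n ^ 2 :=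
  calc 2 * Q.numEdges = ∑ u, Q.deg u := Q.sum_deg.symm
    _ ≤ ∑ _u : Fin n, n := Finset.sum_le_sum fun u _ => by
        simpa [Q.deg_eq_card] using (Q.graph.neighborFinset u).card_le_univ
    _ = n ^ 2 := by simp [sq]

theorem QueryGraph.sum_neighborFinset_one :
    ∑ u, ∑ _w ∈ Q.graph.neighborFinset u, (1 : ℝ≥0∞) = 2 * Q.numEdges := by
  simp only [Finset.sum_const, nsmul_eq_mul, mul_one, ← Q.deg_eq_card]
  exact_mod_cast Q.sum_deg

theorem QueryGraph.sum_neighborFinset_edge {e : Sym2 (Fin n)} (he : e ∈ Q.graph.edgeSet) :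
    ∑ u, ∑ w ∈ Q.graph.neighborFinset u, (if s(u, w) = e then (1 : ℝ≥0∞) else 0) = 2 := by
  induction e using Sym2.ind with | _ a b
  rw [SimpleGraph.mem_edgeSet] at he
  have hab : a ≠ b := he.ne
  have h (u) : ∑ w ∈ Q.graph.neighborFinset u, (if s(u, w) = s(a, b) then (1 : ℝ≥0∞) else 0) =
      (if u = a then 1 else 0) + if u = b then 1 else 0 := by
    rcases eq_or_ne u a with rfl | hua
    · simp [hab, Finset.sum_ite_eq', he]
    rcases eq_or_ne u b with rfl | hub
    · simp [hab.symm, Finset.sum_ite_eq', he.symm]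
    · simp [hua, hub]
  simp only [h, Finset.sum_add_distrib, Finset.sum_ite_eq', Finset.mem_univ, if_true]
  exact one_add_one_eq_two

/-- The number of neighbors that are not heavy. -/
def lightDeg (u : Fin n) : ℕ :=
  ((Q.graph.neighborFinset u).filter fun w => ¬θ < Q.deg w).card

/-- The probability that a trial returns a given edge in the orientation that starts at a given
vertex that is not heavy. -/
def lightWeight (n : ℕ) (θ : ℝ) : ℝ≥0∞ := 2⁻¹ * (n : ℝ≥0∞)⁻¹ * (⌊θ⌋₊ : ℝ≥0∞)⁻¹

/-- The probability that a trial returns a given edge in the orientation that starts at `u`. -/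
def edgeWeight (u : Fin n) : ℝ≥0∞ :=
  lightWeight n θ * if θ < Q.deg u then (Q.deg u : ℝ≥0∞)⁻¹ * lightDeg Q θ u else 1

/-- The expected value of a trial in which returning the edge `ab`, found at `a`, is worth `g a b`
and a failure is worth nothing. -/
def hitValue : ℝ≥0∞ :=
  ∑ u, edgeWeight Q θ u * ∑ w ∈ Q.graph.neighborFinset u, g u w

/-- The probability that a trial fails. -/
def failProb : ℝ≥0∞ := trialValue Q θ (fun _ _ => 0) 1

theorem heavyValue_eq_add (w : Fin n) : heavyValue Q θ g v w =
    heavyValue Q θ g 0 w + heavyValue Q θ (fun _ _ => 0) 1 w * v := by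
  unfold heavyValue
  split_ifs <;> simp

theorem choiceValue_eq_add (u : Fin n) (j : ℕ) : choiceValue Q θ g v u j =
    choiceValue Q θ g 0 u j + choiceValue Q θ (fun _ _ => 0) 1 u j * v := by
  unfold choiceValue
  split_ifs
  · simp
  · rw [heavyValue_eq_add]; ring
  · simp

theorem sum_choiceValue (u : Fin n) : ∑ j : Fin ⌊θ⌋₊, choiceValue Q θ g 0 u j =
    if θ < Q.deg u then 0
    else ∑ w ∈ Q.graph.neighborFinset u, 2⁻¹ * (g u w + heavyValue Q θ g 0 w) := by
  by_cases hd : θ < Q.deg u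
  · simp [choiceValue, hd]
  have hle : Q.deg u ≤ ⌊θ⌋₊ := Nat.le_floor (not_lt.1 hd)
  rw [if_neg hd, ← Q.sum_nbr u fun w => 2⁻¹ * (g u w + heavyValue Q θ g 0 w),
    Fin.sum_univ_eq_sum_range (fun j => choiceValue Q θ g 0 u j),
    ← Finset.sum_subset (Finset.range_subset_range.2 hle) fun j _ hj => ?_,
    ← Fin.sum_univ_eq_sum_range (fun j => choiceValue Q θ g 0 u j)]
  · refine Finset.sum_congr rfl fun j _ => ?_
    rw [choiceValue, if_neg hd, dif_pos j.2]
    rfl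
  · rw [Finset.mem_range] at hj
    simp [choiceValue, hj]

theorem sum_light_sum_neighborFinset (φ : Fin n → ℝ≥0∞) :
    ∑ u, (if θ < Q.deg u then 0 else ∑ w ∈ Q.graph.neighborFinset u, φ w) =
      ∑ w, lightDeg Q θ w * φ w :=
  calc _ = ∑ u with ¬θ < Q.deg u, ∑ w ∈ Q.graph.neighborFinset u, φ w := by
        rw [Finset.sum_filter]
        simp only [ite_not]
    _ = ∑ w, ∑ _u ∈ (Q.graph.neighborFinset w).filter fun u => ¬θ < Q.deg u, φ w := by
        refine Finset.sum_comm' fun u w => ?_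
        simp [SimpleGraph.adj_comm, and_comm]
    _ = _ := by simp [lightDeg]

theorem trialValue_zero : trialValue Q θ g 0 = hitValue Q θ g := by
  have hsplit (u) : (if θ < Q.deg u then (0 : ℝ≥0∞) else
      ∑ w ∈ Q.graph.neighborFinset u, 2⁻¹ * (g u w + heavyValue Q θ g 0 w)) =
      2⁻¹ * ((if θ < Q.deg u then 0 else ∑ w ∈ Q.graph.neighborFinset u, g u w) +
        if θ < Q.deg u then 0 else ∑ w ∈ Q.graph.neighborFinset u, heavyValue Q θ g 0 w) := by
    split_ifs
    · simp
    · rw [← Finset.mul_sum, Finset.sum_add_distrib]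
  simp only [trialValue, hitValue, sum_choiceValue, hsplit]
  simp only [← Finset.mul_sum]
  rw [Finset.sum_add_distrib, sum_light_sum_neighborFinset, ← Finset.sum_add_distrib]
  simp only [Finset.mul_sum _ _ (2 : ℝ≥0∞)⁻¹, Finset.mul_sum _ _ (⌊θ⌋₊ : ℝ≥0∞)⁻¹,
    Finset.mul_sum _ _ (n : ℝ≥0∞)⁻¹]
  refine Finset.sum_congr rfl fun u _ => ?_
  unfold edgeWeight lightWeight heavyValue
  split_ifs
  · rw [Q.sum_nbr u (g u)]
    ring
  · ring

theorem trialValue_eq_add : trialValue Q θ g v = hitValue Q θ g + failProb Q θ * v := by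
  rw [← trialValue_zero]
  unfold failProb trialValue
  simp only [choiceValue_eq_add Q θ g v, Finset.sum_add_distrib, mul_add, ← Finset.sum_mul,
    ← mul_assoc]

variable {θ}

theorem heavyValue_one (hθ : 0 ≤ θ) (w : Fin n) : heavyValue Q θ (fun _ _ => 1) 1 w = 1 := by
  unfold heavyValue
  split_ifs with h
  · have hd : Q.deg w ≠ 0 := by exact_mod_cast (hθ.trans_lt h).ne'
    simp [ENNReal.inv_mul_cancel, hd]
  · rfl

theorem choiceValue_one (hθ : 0 ≤ θ) (u : Fin n) (j : ℕ) :
    choiceValue Q θ (fun _ _ => 1) 1 u j = 1 := by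
  unfold choiceValue
  split_ifs
  · rfl
  · rw [heavyValue_one Q hθ, one_add_one_eq_two, ENNReal.inv_mul_cancel (by simp) (by simp)]
  · rfl

theorem trialValue_one (hn : 0 < n) (hθ : 1 ≤ θ) : trialValue Q θ (fun _ _ => 1) 1 = 1 := by
  simp [trialValue, choiceValue_one Q (zero_le_one.trans hθ), ENNReal.inv_mul_cancel,
    (Nat.floor_pos.2 hθ).ne', hn.ne']

theorem hitValue_one_add_failProb (hn : 0 < n) (hθ : 1 ≤ θ) :
    hitValue Q θ (fun _ _ => 1) + failProb Q θ = 1 := by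
  have h := trialValue_one Q hn hθ
  rwa [trialValue_eq_add, mul_one] at h

theorem card_heavy_mul_le :
    (({u | θ < Q.deg u} : Finset (Fin n)).card : ℝ) * θ ≤ 2 * Q.numEdges :=
  calc (({u | θ < Q.deg u} : Finset (Fin n)).card : ℝ) * θ
      ≤ ∑ u with θ < Q.deg u, (Q.deg u : ℝ) := by
        rw [← nsmul_eq_mul]
        exact Finset.card_nsmul_le_sum _ _ _ fun u hu => (Finset.mem_filter.1 hu).2.le
    _ ≤ ∑ u, (Q.deg u : ℝ) :=
        Finset.sum_le_sum_of_subset_of_nonneg (Finset.filter_subset _ _) fun _ _ _ => by positivity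
    _ = 2 * Q.numEdges := by exact_mod_cast Q.sum_deg

theorem lightDeg_le (u : Fin n) : lightDeg Q θ u ≤ Q.deg u := by
  rw [Q.deg_eq_card]
  exact Finset.card_filter_le _ _

theorem le_lightDeg (hθ : 0 < θ) (hm : 40 * (Q.numEdges : ℝ) ≤ θ ^ 2) {u : Fin n}
    (hu : θ < Q.deg u) : 19 / 20 * (Q.deg u : ℝ) ≤ lightDeg Q θ u := by
  have hsplit : (Q.deg u : ℝ) =
      ((Q.graph.neighborFinset u).filter fun w => θ < Q.deg w).card + lightDeg Q θ u := by
    rw [Q.deg_eq_card]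
    exact_mod_cast (Finset.card_filter_add_card_filter_not _).symm
  have hheavy : (((Q.graph.neighborFinset u).filter fun w => θ < Q.deg w).card : ℝ) ≤ θ / 20 :=
    calc _ ≤ (({u | θ < Q.deg u} : Finset (Fin n)).card : ℝ) := by
          exact_mod_cast Finset.card_le_card (Finset.filter_subset_filter _ (Finset.subset_univ _))
      _ ≤ 2 * Q.numEdges / θ := (le_div_iff₀ hθ).2 (card_heavy_mul_le Q)
      _ ≤ θ / 20 := by rw [div_le_iff₀ hθ]; linarith
  linarith

theorem edgeWeight_le (u : Fin n) : edgeWeight Q θ u ≤ lightWeight n θ := by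
  refine mul_le_of_le_one_right zero_le ?_
  split_ifs
  · rw [mul_comm, ← div_eq_mul_inv]
    exact ENNReal.div_le_of_le_mul (by simpa using lightDeg_le Q u)
  · rfl

theorem le_edgeWeight (hθ : 0 < θ) (hm : 40 * (Q.numEdges : ℝ) ≤ θ ^ 2) (u : Fin n) :
    lightWeight n θ * ENNReal.ofReal (19 / 20) ≤ edgeWeight Q θ u := by
  unfold edgeWeight
  gcongr
  split_ifs with h
  · have hd : (0 : ℝ) < Q.deg u := hθ.trans h
    rw [← ENNReal.ofReal_natCast, ← ENNReal.ofReal_natCast, ← ENNReal.ofReal_inv_of_pos hd,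
      ← ENNReal.ofReal_mul (by positivity)]
    refine ENNReal.ofReal_le_ofReal ?_
    rw [inv_mul_eq_div, le_div_iff₀ hd]
    exact le_lightDeg Q hθ hm h
  · rw [ENNReal.ofReal_le_one]
    norm_num

variable {g}

theorem hitValue_le :
    hitValue Q θ g ≤ lightWeight n θ * ∑ u, ∑ w ∈ Q.graph.neighborFinset u, g u w := by
  rw [Finset.mul_sum]
  exact Finset.sum_le_sum fun u _ => mul_le_mul_left (edgeWeight_le Q u) _

theorem le_hitValue (hθ : 0 < θ) (hm : 40 * (Q.numEdges : ℝ) ≤ θ ^ 2) :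
    lightWeight n θ * ENNReal.ofReal (19 / 20) * ∑ u, ∑ w ∈ Q.graph.neighborFinset u, g u w ≤
      hitValue Q θ g := by
  rw [Finset.mul_sum]
  exact Finset.sum_le_sum fun u _ => mul_le_mul_left (le_edgeWeight Q hθ hm u) _

end Trial

/-! ### The edge sampler -/

section Staged

variable (c q : ℕ → ℝ≥0∞) (v : ℝ≥0∞)

/-- The expected gain in the stages `k`, …, `A - 1` of a process that earns `q i` in stage `i`,
stops after stage `i` unless an event of probability `c i` happens, and finally earns `v` if it
does not stop before stage `A`. -/
def stagedValue (A k : ℕ) : ℝ≥0∞ :=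
  ∑ i ∈ Finset.Ico k A, (∏ j ∈ Finset.Ico k i, c j) * q i + (∏ j ∈ Finset.Ico k A, c j) * v

theorem stagedValue_self (A : ℕ) : stagedValue c q v A A = v := by
  simp [stagedValue]

theorem stagedValue_of_lt {A k : ℕ} (hk : k < A) :
    stagedValue c q v A k = q k + c k * stagedValue c q v A (k + 1) := by
  have hsum : ∑ i ∈ Finset.Ico (k + 1) A, (∏ j ∈ Finset.Ico k i, c j) * q i =
      c k * ∑ i ∈ Finset.Ico (k + 1) A, (∏ j ∈ Finset.Ico (k + 1) i, c j) * q i := by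
    rw [Finset.mul_sum]
    refine Finset.sum_congr rfl fun i hi => ?_
    rw [Finset.prod_eq_prod_Ico_succ_bot (Finset.mem_Ico.1 hi).1, mul_assoc]
  rw [stagedValue, Finset.sum_eq_sum_Ico_succ_bot hk, Finset.prod_eq_prod_Ico_succ_bot hk, hsum,
    Finset.Ico_self, Finset.prod_empty, stagedValue]
  ring

theorem stagedValue_zero_eq_add {t A : ℕ} (ht : t ≤ A) : stagedValue c q v A 0 =
    ∑ i ∈ Finset.range t, (∏ j ∈ Finset.range i, c j) * q i +
      (∏ j ∈ Finset.range t, c j) * stagedValue c q v A t := by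
  induction t with
  | zero => simp
  | succ t ih =>
    rw [ih (Nat.le_of_succ_le ht), stagedValue_of_lt c q v ht, Finset.sum_range_succ,
      Finset.prod_range_succ]
    ring

variable {c q v} {p : ℕ → ℝ≥0∞} {κ a : ℝ≥0∞} {A k t : ℕ}

theorem stagedValue_eq_one (h : ∀ i < A, p i + c i = 1) (hk : k ≤ A) :
    stagedValue c p 1 A k = 1 := by
  induction hk using Nat.decreasingInduction with
  | self => exact stagedValue_self c p 1 A
  | of_succ k hk ih => rw [stagedValue_of_lt c p 1 hk, ih, mul_one, h k hk]

theorem stagedValue_le_one (h : ∀ i < A, q i + c i ≤ 1) (hv : v ≤ 1) (hk : k ≤ A) :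
    stagedValue c q v A k ≤ 1 := by
  induction hk using Nat.decreasingInduction with
  | self => rwa [stagedValue_self]
  | of_succ k hk ih =>
    rw [stagedValue_of_lt c q v hk]
    exact (add_le_add_right (mul_le_of_le_one_right zero_le ih) _).trans (h k hk)

theorem sum_range_prod_mul_add_prod (h : ∀ i < t, p i + c i = 1) :
    ∑ i ∈ Finset.range t, (∏ j ∈ Finset.range i, c j) * p i + ∏ j ∈ Finset.range t, c j = 1 := by
  rw [← stagedValue_eq_one h (Nat.zero_le t), stagedValue_zero_eq_add c p 1 le_rfl,
    stagedValue_self, mul_one]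

theorem le_stagedValue_zero_add (ht : t ≤ A) (h : ∀ i < t, p i + c i = 1)
    (hq : ∀ i < t, κ * p i ≤ q i) :
    κ ≤ stagedValue c q v A 0 + κ * ∏ j ∈ Finset.range t, c j :=
  calc κ = ∑ i ∈ Finset.range t, (∏ j ∈ Finset.range i, c j) * (κ * p i) +
        κ * ∏ j ∈ Finset.range t, c j := by
        conv_lhs => rw [← mul_one κ, ← sum_range_prod_mul_add_prod h, mul_add, Finset.mul_sum]
        simp only [mul_left_comm]
    _ ≤ ∑ i ∈ Finset.range t, (∏ j ∈ Finset.range i, c j) * q i +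
        κ * ∏ j ∈ Finset.range t, c j := by
        gcongr with i hi
        exact hq i (Finset.mem_range.1 hi)
    _ ≤ _ := by
        rw [stagedValue_zero_eq_add c q v ht]
        gcongr
        exact le_self_add

theorem stagedValue_zero_le_add (ht : t ≤ A) (h : ∀ i < t, p i + c i = 1)
    (hq : ∀ i < t, q i ≤ κ * p i) :
    stagedValue c q v A 0 ≤ κ + (∏ j ∈ Finset.range t, c j) * stagedValue c q v A t := by
  rw [stagedValue_zero_eq_add c q v ht]
  gcongr
  calc _ ≤ ∑ i ∈ Finset.range t, (∏ j ∈ Finset.range i, c j) * (κ * p i) := by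
        gcongr with i hi
        exact hq i (Finset.mem_range.1 hi)
    _ = κ * ∑ i ∈ Finset.range t, (∏ j ∈ Finset.range i, c j) * p i := by
        rw [Finset.mul_sum]
        simp only [mul_left_comm]
    _ ≤ κ := mul_le_of_le_one_right zero_le (le_self_add.trans_eq (sum_range_prod_mul_add_prod h))

theorem stagedValue_const_le (hc : ∀ i < A, c i ≤ 1) :
    stagedValue c (fun _ => a) v A k ≤ A * a + v := by
  have hprod {i : ℕ} (hi : i ≤ A) : ∏ j ∈ Finset.Ico k i, c j ≤ 1 :=
    Finset.prod_le_one' fun j hj => hc j ((Finset.mem_Ico.1 hj).2.trans_le hi)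
  calc stagedValue c (fun _ => a) v A k ≤ ∑ _i ∈ Finset.Ico k A, 1 * a + 1 * v := by
        unfold stagedValue
        gcongr with i hi
        · exact hprod (Finset.mem_Ico.1 hi).2.le
        · exact hprod le_rfl
    _ ≤ A * a + v := by
        simp only [one_mul, Finset.sum_const, Nat.card_Ico, nsmul_eq_mul]
        gcongr
        exact Nat.sub_le A k

theorem stagedValue_const_zero_le (hc : ∀ i < A, c i ≤ 1) (ht : t ≤ A) :
    stagedValue c (fun _ => a) v A 0 ≤ t * a + (∏ j ∈ Finset.range t, c j) * (A * a + v) := by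
  rw [stagedValue_zero_eq_add c _ v ht]
  gcongr
  · calc _ ≤ ∑ _i ∈ Finset.range t, 1 * a := by
          gcongr with i hi
          exact Finset.prod_le_one' fun j hj =>
            hc j ((Finset.mem_range.1 hj).trans ((Finset.mem_range.1 hi).trans_le ht))
      _ = t * a := by simp
  · exact stagedValue_const_le hc

end Staged

section Sampler

/-- The part of the sampler that computes `numDoublings δ (20 * n ^ 2)` in register `7`. -/
def samplerComputeLen : List (Prog ℕ) :=
  [.op (.const 5 1),
   .op (.const 3 0),
   .op (.const 8 20),
   .op (.mul 8 8 0),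
   .op (.mul 8 8 0),
   .op (.copy 6 2),
   .op (.const 7 0),
   .loop 6 8 (.block [.op (.add 6 6 6), .op (.add 7 7 5)])]

/-- The part of the sampler that computes the maximal number of trials in register `9`. -/
def samplerComputeTotal : List (Prog ℕ) :=
  [.op (.const 9 160),
   .op (.mul 9 9 0),
   .op (.mul 9 9 7),
   .op (.const 10 0)]

/-- The trials of the sampler, up to the first one that returns an edge. -/
def samplerLoop : Prog ℕ :=
  .loop 10 9 samplerTrial

/-- An almost uniform edge sampler with accuracy `0.1`. -/
def edgeSampler : Prog ℕ :=
  .block (samplerComputeLen ++ samplerComputeTotal ++ [samplerLoop])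

/-- The maximal number of trials of the sampler. -/
def numTrials (n : ℕ) (δ : ℝ) : ℕ :=
  160 * n * numDoublings δ (20 * n ^ 2)

variable {n : ℕ} {Q : QueryGraph n} {g : Fin n → Fin n → ℝ≥0∞} {v : ℝ≥0∞}

theorem runsTo_samplerComputeLen (Q : QueryGraph n) (hn : 0 < n) {η δ : ℝ} (hδ : 0 < δ)
    {σ : Store ℕ} (hσ : SamplerInput n η δ σ) :
    RunsTo Q samplerComputeLen σ (numDoublings δ (20 * n ^ 2) * 6 + 16) fun σ =>
      σ 0 = n ∧ σ 3 = 0 ∧ σ 5 = 1 ∧ σ 7 = numDoublings δ (20 * n ^ 2) := by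
  obtain ⟨h0, -, h2⟩ := hσ
  have hn2 : (0 : ℝ) < 20 * n ^ 2 := by positivity
  let I (j : ℕ) (σ : Store ℕ) : Prop :=
    (σ 0 = n ∧ σ 3 = 0 ∧ σ 5 = 1 ∧ σ 7 = j) ∧ σ 6 = δ * 2 ^ j ∧ σ 8 = 20 * n ^ 2
  refine .op rfl <| .op rfl <| .op rfl <| .op rfl <| .op rfl <| .op rfl <| .op rfl <|
    .mono (fun σ hσ => hσ.1) <| .loop (I := I) ⟨?_, ?_, ?_⟩ (fun j hj σ hσ => ?_) fun σ hσ => ?_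
  · simp [h0]
  · simp [h2]
  · simp [h0, sq, mul_assoc]
  · obtain ⟨⟨h0, h3, h5, h7⟩, h6, h8⟩ := hσ
    refine ⟨?_, .op rfl <| .op rfl <| .nil ⟨?_, ?_, ?_⟩⟩
    · rw [h6, h8]
      exact (lt_numDoublings_iff hδ hn2).1 hj
    · simp [*]
    · simp [h6, pow_succ, mul_two, mul_add]
    · simp [h8]
  · obtain ⟨-, h6, h8⟩ := hσ
    rw [h6, h8, not_lt]
    exact le_mul_two_pow_numDoublings hδ hn2

theorem runsTo_samplerComputeTotal (Q : QueryGraph n) {δ : ℝ} {σ : Store ℕ}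
    (hσ : σ 0 = n ∧ σ 3 = 0 ∧ σ 5 = 1 ∧ σ 7 = numDoublings δ (20 * n ^ 2)) :
    RunsTo Q samplerComputeTotal σ 8 (SamplerState n (numTrials n δ) 0) := by
  obtain ⟨h0, h3, h5, h7⟩ := hσ
  refine .op rfl <| .op rfl <| .op rfl <| .op rfl <| .nil ?_
  constructor <;> simp [*, numTrials]

theorem one_le_threshold {A k : ℕ} (hk : k < A) : 1 ≤ (A : ℝ) / (k + 1) := by
  rw [one_le_div (by positivity)]
  exact_mod_cast hk

theorem cost_samplerLoop {A : ℕ} (hn : 0 < n) {f : Store ℕ → ℝ≥0∞}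
    (hv : ∀ σ, SamplerState n A A σ → f σ = v) (hg : ∀ a b σ, SamplerDone A a b σ → f σ = g a b)
    {k : ℕ} (hk : k ≤ A) {σ : Store ℕ} (hσ : SamplerState n A k σ) :
    samplerLoop.cost Q 0 f σ = stagedValue (fun k => failProb Q (A / (k + 1)))
      (fun k => hitValue Q (A / (k + 1)) g) v A k := by
  induction hk using Nat.decreasingInduction generalizing σ with
  | self =>
    rw [samplerLoop, Prog.cost_loop_neg _ _ _ (by rw [hσ.trials, hσ.total]; exact lt_irrefl _),
      zero_add, stagedValue_self, hv σ hσ]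
  | of_succ k hk ih =>
    have hlt : σ 10 < σ 9 := by
      rw [hσ.trials, hσ.total]
      exact_mod_cast hk
    have hdone (a b : Fin n) (σ) (h : SamplerDone A a b σ) :
        samplerLoop.cost Q 0 f σ = g a b := by
      rw [samplerLoop, Prog.cost_loop_neg _ _ _ (by rw [h.trials, h.total]; exact lt_irrefl _),
        zero_add, hg a b σ h]
    rw [samplerLoop, Prog.cost_loop_pos _ _ _ hlt, ← samplerLoop, zero_add,
      cost_samplerTrial (fun σ h => ih (by exact_mod_cast h)) hdone hσ hn (one_le_threshold hk),
      trialValue_eq_add, stagedValue_of_lt _ _ _ hk]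

theorem haltProb_edgeSampler (hn : 0 < n) {η δ : ℝ} (hδ : 0 < δ) {E : Set (Store ℕ)}
    (hv : ∀ σ, SamplerState n (numTrials n δ) (numTrials n δ) σ → E.indicator 1 σ = v)
    (hg : ∀ a b σ, SamplerDone (numTrials n δ) a b σ → E.indicator 1 σ = g a b)
    {σ : Store ℕ} (hσ : SamplerInput n η δ σ) :
    haltProb Q edgeSampler σ E = stagedValue (fun k => failProb Q (numTrials n δ / (k + 1)))
      (fun k => hitValue Q (numTrials n δ / (k + 1)) g) v (numTrials n δ) 0 := by
  obtain ⟨σ', hσ', hcost⟩ := (runsTo_samplerComputeLen Q hn hδ hσ).append fun _ =>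
    runsTo_samplerComputeTotal Q
  rw [haltProb_eq_cost, edgeSampler, hcost, Prog.cost_block_cons, Prog.cost_zero_block_nil,
    cost_samplerLoop hn hv hg (Nat.zero_le _) hσ', mul_zero, zero_add, zero_add]

theorem cost_samplerTrial_le {A : ℝ} {k : ℕ} {F : Store ℕ → ℝ≥0∞} {a : ℝ≥0∞}
    (hv : ∀ σ, SamplerState n A (k + 1) σ → F σ ≤ v)
    (ha : ∀ (a' b' : Fin n) σ, SamplerDone A a' b' σ → F σ ≤ a) {σ : Store ℕ}
    (hσ : SamplerState n A k σ) (hn : 0 < n) (hA : 1 ≤ A / (k + 1)) :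
    samplerTrial.cost Q 0 F σ ≤ trialValue Q (A / (k + 1)) (fun _ _ => a) v := by
  classical
  let F' (σ : Store ℕ) : ℝ≥0∞ :=
    if SamplerState n A (k + 1) σ then v
    else if ∃ a' b' : Fin n, SamplerDone A a' b' σ then a else ⊤
  have hle : F ≤ F' := by
    intro σ
    simp only [F']
    split_ifs with hstate hdone
    · exact hv σ hstate
    · obtain ⟨a', b', hdone⟩ := hdone
      exact ha a' b' σ hdone
    · exact le_top
  have hF' (a' b' : Fin n) (σ) (h : SamplerDone A a' b' σ) : F' σ = a := by
    have hnot : ¬SamplerState n A (k + 1) σ := fun h' =>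
      absurd (one_le_vertexLabel a') (by rw [← h.fst, h'.result]; norm_num)
    simp only [F', if_neg hnot, if_pos (⟨a', b', h⟩ : ∃ a' b' : Fin n, SamplerDone A a' b' σ)]
  calc samplerTrial.cost Q 0 F σ ≤ samplerTrial.cost Q 0 F' σ := Prog.cost_mono Q 0 hle _ _
    _ = _ := cost_samplerTrial (fun σ h => if_pos h) hF' hσ hn hA

theorem time_samplerTrial_le (Q : QueryGraph n) (σ : Store ℕ) :
    samplerTrial.cost Q 1 (fun _ => 0) σ ≤ 60 := by
  refine (Prog.time_le_maxTime Q _ σ).trans ?_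
  norm_num [samplerTrial, samplerFound, returnHeavyEdge, returnFoundEdge, Prog.block, Prog.maxTime]

theorem time_samplerLoop_le {A : ℕ} (hn : 0 < n) {k : ℕ} (hk : k ≤ A) {σ : Store ℕ}
    (hσ : SamplerState n A k σ) :
    samplerLoop.cost Q 1 (fun _ => 0) σ ≤
      stagedValue (fun k => failProb Q (A / (k + 1))) (fun _ => 62) 1 A k := by
  induction hk using Nat.decreasingInduction generalizing σ with
  | self =>
    rw [samplerLoop, Prog.cost_loop_neg _ _ _ (by rw [hσ.trials, hσ.total]; exact lt_irrefl _),
      add_zero, stagedValue_self]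
  | of_succ k hk ih =>
    have hlt : σ 10 < σ 9 := by
      rw [hσ.trials, hσ.total]
      exact_mod_cast hk
    have hdone (a b : Fin n) (σ) (h : SamplerDone A a b σ) :
        samplerLoop.cost Q 1 (fun _ => 0) σ ≤ 1 := by
      rw [samplerLoop, Prog.cost_loop_neg _ _ _ (by rw [h.trials, h.total]; exact lt_irrefl _),
        add_zero]
    have hhit : hitValue Q (A / (k + 1)) (fun _ _ => 1) ≤ 1 :=
      le_self_add.trans_eq (hitValue_one_add_failProb Q hn (one_le_threshold hk))
    rw [samplerLoop, Prog.cost_loop_pos _ _ _ hlt, ← samplerLoop, Prog.cost_eq_time_add,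
      stagedValue_of_lt _ _ _ hk]
    calc _ ≤ 1 + (60 + trialValue Q (A / (k + 1)) (fun _ _ => 1)
          (stagedValue (fun k => failProb Q (A / (k + 1))) (fun _ => 62) 1 A (k + 1))) :=
          add_le_add_right (add_le_add (time_samplerTrial_le Q σ) <| cost_samplerTrial_le
            (fun σ h => ih (by exact_mod_cast h)) hdone hσ hn (one_le_threshold hk)) _
      _ ≤ _ := by
          rw [trialValue_eq_add, ← add_assoc, ← add_assoc]
          refine add_le_add_left ((add_le_add_right hhit _).trans_eq ?_) _
          norm_num

theorem expectedTime_edgeSampler_le (hn : 0 < n) {η δ : ℝ} (hδ : 0 < δ) {σ : Store ℕ}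
    (hσ : SamplerInput n η δ σ) :
    expectedTime Q edgeSampler σ ≤ numDoublings δ (20 * n ^ 2) * 6 + 26 +
      stagedValue (fun k => failProb Q (numTrials n δ / (k + 1))) (fun _ => 62) 1
        (numTrials n δ) 0 := by
  obtain ⟨σ', hσ', hcost⟩ := (runsTo_samplerComputeLen Q hn hδ hσ).append fun _ =>
    runsTo_samplerComputeTotal Q
  have hnil : (Prog.block []).cost Q 1 (fun _ => 0) = fun _ : Store ℕ => (1 : ℝ≥0∞) := by
    funext σ
    rw [Prog.cost_block_nil, add_zero]
  rw [expectedTime_eq_cost, edgeSampler, hcost, Prog.cost_block_cons, hnil, Prog.cost_eq_time_add]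
  calc _ ≤ _ := add_le_add_right (add_le_add_right (add_le_add
        (time_samplerLoop_le hn (Nat.zero_le _) hσ')
        (Prog.cost_zero_le Q (fun _ => le_rfl) _ _)) _) _
    _ = _ := by
        push_cast
        ring

end Sampler

section GoodTrials

/-- The number of trials whose threshold is large enough for the edges to be almost equally
likely. -/
def goodTrials (A m : ℕ) : ℕ := ⌊(A : ℝ) / √(40 * m)⌋₊

variable {A m : ℕ}

theorem goodTrials_le (hm : 0 < m) : goodTrials A m ≤ A := by
  refine Nat.floor_le_of_le (div_le_self (Nat.cast_nonneg A) ?_)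
  rw [Real.one_le_sqrt]
  exact_mod_cast (show 1 ≤ 40 * m by lia)

theorem le_threshold_sq (hm : 0 < m) {k : ℕ} (hk : k < goodTrials A m) :
    40 * (m : ℝ) ≤ ((A : ℝ) / (k + 1)) ^ 2 := by
  have hle : ((k + 1 : ℕ) : ℝ) ≤ A / √(40 * m) := (Nat.le_floor_iff (by positivity)).1 hk
  rw [← Real.sqrt_le_left (by positivity), le_div_comm₀ (by positivity) (by positivity)]
  exact_mod_cast hle

theorem sq_div_le_sum_goodTrials (hm : 0 < m) (hA : √(40 * m) ≤ A) :
    (A : ℝ) ^ 2 / (160 * m) ≤ ∑ k ∈ Finset.range (goodTrials A m), ((k : ℝ) + 1) := by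
  have hsum (t : ℕ) : ∑ k ∈ Finset.range t, ((k : ℝ) + 1) = t * (t + 1) / 2 := by
    induction t with
    | zero => simp
    | succ t ih =>
      rw [Finset.sum_range_succ, ih]
      push_cast
      ring
  have hlt : (A : ℝ) / √(40 * m) < goodTrials A m + 1 := Nat.lt_floor_add_one _
  have hone : (1 : ℝ) ≤ goodTrials A m := by
    exact Nat.one_le_cast.2 (Nat.floor_pos.2 ((one_le_div (by positivity)).2 hA))
  have hsq : (A : ℝ) ^ 2 / (160 * m) = (A / √(40 * m)) ^ 2 / 4 := by
    rw [div_pow, Real.sq_sqrt (by positivity)]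
    ring
  have hnonneg : 0 ≤ (A : ℝ) / √(40 * m) := by positivity
  rw [hsum, hsq]
  nlinarith

end GoodTrials

section Failure

variable {n : ℕ} (Q : QueryGraph n) {θ : ℝ} {δ : ℝ}

theorem QueryGraph.two_mul_numEdges_le_sq : 2 * (Q.numEdges : ℝ) ≤ n ^ 2 := by
  exact_mod_cast Q.two_mul_numEdges_le

theorem QueryGraph.pos_of_numEdges_pos (hm : 0 < Q.numEdges) : 0 < n := by
  have h := Q.two_mul_numEdges_le
  by_contra! hn
  obtain rfl : n = 0 := by lia
  lia

theorem ofReal_le_hitValue_one (hn : 0 < n) (hθ : 1 ≤ θ) (hm : 40 * (Q.numEdges : ℝ) ≤ θ ^ 2) :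
    ENNReal.ofReal (19 / 20 * Q.numEdges / (n * θ)) ≤ hitValue Q θ fun _ _ => 1 := by
  have hfloor : (0 : ℝ) < ⌊θ⌋₊ := by exact_mod_cast Nat.floor_pos.2 hθ
  calc ENNReal.ofReal (19 / 20 * Q.numEdges / (n * θ))
      ≤ ENNReal.ofReal (19 / 20 * Q.numEdges / (n * ⌊θ⌋₊)) := by
        gcongr
        exact Nat.floor_le (by linarith)
    _ = lightWeight n θ * ENNReal.ofReal (19 / 20) * (2 * Q.numEdges) := by
        rw [ENNReal.ofReal_div_of_pos (by positivity), ENNReal.ofReal_mul (by norm_num),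
          ENNReal.ofReal_mul (by positivity), ENNReal.ofReal_natCast, ENNReal.ofReal_natCast,
          ENNReal.ofReal_natCast, ENNReal.div_eq_inv_mul,
          ENNReal.mul_inv (by simp) (by simp), lightWeight]
        calc _ = (n : ℝ≥0∞)⁻¹ * (⌊θ⌋₊ : ℝ≥0∞)⁻¹ * (ENNReal.ofReal (19 / 20) * Q.numEdges) *
              (2⁻¹ * 2) := by
              rw [ENNReal.inv_mul_cancel two_ne_zero ENNReal.ofNat_ne_top, mul_one]
          _ = _ := by ring
    _ ≤ _ := by
        rw [← Q.sum_neighborFinset_one]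
        exact le_hitValue Q (by linarith) hm

theorem failProb_le_one (hn : 0 < n) (hθ : 1 ≤ θ) : failProb Q θ ≤ 1 :=
  le_add_self.trans_eq (hitValue_one_add_failProb Q hn hθ)

theorem failProb_le_exp (hn : 0 < n) (hθ : 1 ≤ θ) (hm : 40 * (Q.numEdges : ℝ) ≤ θ ^ 2) :
    failProb Q θ ≤ ENNReal.ofReal (Real.exp (-(19 / 20 * Q.numEdges / (n * θ)))) := by
  have hsum : ENNReal.ofReal (19 / 20 * Q.numEdges / (n * θ)) + failProb Q θ ≤ 1 :=
    (add_le_add_left (ofReal_le_hitValue_one Q hn hθ hm) _).trans_eq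
      (hitValue_one_add_failProb Q hn hθ)
  calc failProb Q θ ≤ 1 - ENNReal.ofReal (19 / 20 * Q.numEdges / (n * θ)) :=
        ENNReal.le_sub_of_add_le_left ENNReal.ofReal_ne_top hsum
    _ = ENNReal.ofReal (1 - 19 / 20 * Q.numEdges / (n * θ)) := by
        rw [ENNReal.ofReal_sub _ (by positivity), ENNReal.ofReal_one]
    _ ≤ _ := ENNReal.ofReal_le_ofReal (Real.one_sub_le_exp_neg _)

theorem prod_failProb_le_exp (hm : 0 < Q.numEdges) {A : ℕ} (hA : √(40 * Q.numEdges) ≤ A) :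
    ∏ k ∈ Finset.range (goodTrials A Q.numEdges), failProb Q (A / (k + 1)) ≤
      ENNReal.ofReal (Real.exp (-(19 / 20 * A / (160 * n)))) := by
  have hn := Q.pos_of_numEdges_pos hm
  have hA0 : (0 : ℝ) < A := (Real.sqrt_pos.2 (by positivity)).trans_le hA
  calc _ ≤ ∏ k ∈ Finset.range (goodTrials A Q.numEdges),
          ENNReal.ofReal (Real.exp (-(19 / 20 * Q.numEdges / (n * A) * (k + 1)))) := by
        gcongr with k hk
        have hk := Finset.mem_range.1 hk
        refine (failProb_le_exp Q hn (one_le_threshold (hk.trans_le (goodTrials_le hm)))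
          (le_threshold_sq hm hk)).trans_eq ?_
        congr 3
        field_simp
    _ = ENNReal.ofReal (Real.exp (-(19 / 20 * Q.numEdges / (n * A) *
          ∑ k ∈ Finset.range (goodTrials A Q.numEdges), ((k : ℝ) + 1)))) := by
        rw [← ENNReal.ofReal_prod_of_nonneg fun k _ => (Real.exp_pos _).le, ← Real.exp_sum,
          Finset.sum_neg_distrib, ← Finset.mul_sum]
    _ ≤ ENNReal.ofReal (Real.exp (-(19 / 20 * Q.numEdges / (n * A) *
          (A ^ 2 / (160 * Q.numEdges))))) := by
        gcongr
        exact sq_div_le_sum_goodTrials hm hA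
    _ = _ := by
        congr 3
        field_simp

theorem numDoublings_ratio_pos (hn : 0 < n) (hδ : 0 < δ) (hδ1 : δ < 1) :
    0 < numDoublings δ (20 * n ^ 2) := by
  have hn1 : (1 : ℝ) ≤ n := by exact_mod_cast hn
  exact numDoublings_pos hδ (by nlinarith)

theorem sqrt_forty_mul_numEdges_le_numTrials (hn : 0 < n) (hδ : 0 < δ) (hδ1 : δ < 1) :
    √(40 * Q.numEdges) ≤ numTrials n δ := by
  have hL : (1 : ℝ) ≤ numDoublings δ (20 * n ^ 2) := by
    exact_mod_cast numDoublings_ratio_pos hn hδ hδ1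
  have hedges := Q.two_mul_numEdges_le_sq
  calc √(40 * Q.numEdges) ≤ 160 * n := Real.sqrt_le_iff.2 ⟨by positivity, by nlinarith⟩
    _ ≤ 160 * n * numDoublings δ (20 * n ^ 2) := le_mul_of_one_le_right (by positivity) hL
    _ = numTrials n δ := by
        rw [numTrials]
        push_cast
        rfl

theorem prod_failProb_numTrials_le (hm : 0 < Q.numEdges) (hδ : 0 < δ) (hδ1 : δ < 1) :
    ∏ k ∈ Finset.range (goodTrials (numTrials n δ) Q.numEdges),
      failProb Q (numTrials n δ / (k + 1)) ≤ ENNReal.ofReal (δ / (20 * n ^ 2)) := by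
  have hn := Q.pos_of_numEdges_pos hm
  refine (prod_failProb_le_exp Q hm
    (sqrt_forty_mul_numEdges_le_numTrials Q hn hδ hδ1)).trans (ENNReal.ofReal_le_ofReal ?_)
  refine exp_neg_le_div_of_numDoublings_le hδ (by positivity) ?_
  have hL : 19 / 20 * (numTrials n δ : ℝ) / (160 * n) =
      numDoublings δ (20 * n ^ 2) * (19 / 20) := by
    rw [numTrials]
    push_cast
    field_simp
  rw [hL]
  gcongr
  linarith [Real.log_two_lt_d9]

theorem div_twenty_mul_sq_le (hm : 0 < Q.numEdges) (hδ1 : δ < 1) :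
    δ / (20 * n ^ 2) ≤ 1 / 40 / Q.numEdges := by
  have hn := Q.pos_of_numEdges_pos hm
  have hedges := Q.two_mul_numEdges_le_sq
  rw [div_div, div_le_div_iff₀ (by positivity) (by positivity)]
  nlinarith

end Failure

section Correctness

variable {n : ℕ} {Q : QueryGraph n} {A : ℝ} {k : ℕ} {a b : Fin n} {e : Sym2 (Fin n)}
  {σ : Store ℕ} {θ η δ : ℝ}

theorem SamplerState.notMem_returnsEdge (h : SamplerState n A k σ) : σ ∉ returnsEdge e :=
  fun he => Set.disjoint_left.1 (disjoint_returnsEdge_returnsNoEdge e) he h.result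

theorem SamplerState.notMem_returnsSomeEdge (h : SamplerState n A k σ) : σ ∉ returnsSomeEdge Q :=
  fun ⟨_, _, he⟩ => h.notMem_returnsEdge he

theorem SamplerDone.mem_returnsEdge_iff (h : SamplerDone A a b σ) :
    σ ∈ returnsEdge e ↔ s(a, b) = e := by
  have hab : σ ∈ returnsEdge s(a, b) := ⟨a, b, rfl, h.fst, h.snd⟩
  refine ⟨fun he => ?_, fun he => he ▸ hab⟩
  by_contra hne
  exact Set.disjoint_left.1 (disjoint_returnsEdge hne) hab he

theorem SamplerDone.mem_returnsSomeEdge_iff (h : SamplerDone A a b σ) :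
    σ ∈ returnsSomeEdge Q ↔ Q.graph.Adj a b := by
  simp [returnsSomeEdge, h.mem_returnsEdge_iff]

theorem SamplerDone.notMem_returnsNoEdge (h : SamplerDone A a b σ) : σ ∉ returnsNoEdge :=
  Set.disjoint_left.1 (disjoint_returnsEdge_returnsNoEdge s(a, b)) (h.mem_returnsEdge_iff.2 rfl)

open Classical in
theorem hitValue_adj (Q : QueryGraph n) (θ : ℝ) :
    (hitValue Q θ fun a b => if Q.graph.Adj a b then 1 else 0) = hitValue Q θ fun _ _ => 1 := by
  unfold hitValue
  congr! 3 with u _ w hw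
  exact if_pos ((Q.graph.mem_neighborFinset u w).1 hw)

open Classical in
theorem hitValue_edge_le_hitValue_one (Q : QueryGraph n) (θ : ℝ) (e : Sym2 (Fin n)) :
    (hitValue Q θ fun a b => if s(a, b) = e then 1 else 0) ≤ hitValue Q θ fun _ _ => 1 := by
  unfold hitValue
  gcongr
  exact ite_le_one le_rfl zero_le_one

open Classical in
theorem hitValue_edge_le (hm : 0 < Q.numEdges) (hθ : 0 < θ) (hm' : 40 * (Q.numEdges : ℝ) ≤ θ ^ 2)
    (he : e ∈ Q.graph.edgeSet) :
    (hitValue Q θ fun a b => if s(a, b) = e then 1 else 0) ≤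
      ENNReal.ofReal (20 / 19 / Q.numEdges) * hitValue Q θ fun _ _ => 1 := by
  have hone : ENNReal.ofReal (20 / 19 / Q.numEdges) * (ENNReal.ofReal (19 / 20) * Q.numEdges) =
      1 := by
    rw [← ENNReal.ofReal_natCast, ← ENNReal.ofReal_mul (by norm_num),
      ← ENNReal.ofReal_mul (by positivity), ENNReal.ofReal_eq_one]
    field_simp
  calc _ ≤ lightWeight n θ * 2 := by
        rw [← Q.sum_neighborFinset_edge he]
        exact hitValue_le Q
    _ = ENNReal.ofReal (20 / 19 / Q.numEdges) *
        (lightWeight n θ * ENNReal.ofReal (19 / 20) * (2 * Q.numEdges)) := by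
        rw [← mul_one (lightWeight n θ * 2), ← hone]
        ring
    _ ≤ _ := by
        gcongr
        rw [← Q.sum_neighborFinset_one]
        exact le_hitValue Q hθ hm'

open Classical in
theorem le_hitValue_edge (hm : 0 < Q.numEdges) (hθ : 0 < θ) (hm' : 40 * (Q.numEdges : ℝ) ≤ θ ^ 2)
    (he : e ∈ Q.graph.edgeSet) :
    (ENNReal.ofReal (19 / 20 / Q.numEdges) * hitValue Q θ fun _ _ => 1) ≤
      hitValue Q θ fun a b => if s(a, b) = e then 1 else 0 := by
  have hcancel : ENNReal.ofReal (19 / 20 / Q.numEdges) * Q.numEdges = ENNReal.ofReal (19 / 20) := by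
    rw [← ENNReal.ofReal_natCast, ← ENNReal.ofReal_mul (by positivity)]
    congr 1
    field_simp
  calc _ ≤ ENNReal.ofReal (19 / 20 / Q.numEdges) * (lightWeight n θ * (2 * Q.numEdges)) := by
        gcongr
        rw [← Q.sum_neighborFinset_one]
        exact hitValue_le Q
    _ = lightWeight n θ * ENNReal.ofReal (19 / 20) * 2 := by
        rw [← hcancel]
        ring
    _ ≤ _ := by
        rw [← Q.sum_neighborFinset_edge he]
        exact le_hitValue Q hθ hm'

theorem hitValue_one_add_failProb_of_lt (Q : QueryGraph n) (hn : 0 < n) {A : ℕ} :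
    ∀ k < A, (hitValue Q (A / (k + 1)) fun _ _ => 1) + failProb Q (A / (k + 1)) = 1 :=
  fun _ hk => hitValue_one_add_failProb Q hn (one_le_threshold hk)

theorem haltProb_edgeSampler_union (hm : 0 < Q.numEdges) (hδ : 0 < δ)
    (hσ : SamplerInput n η δ σ) :
    haltProb Q edgeSampler σ (returnsSomeEdge Q ∪ returnsNoEdge) = 1 := by
  classical
  have hn := Q.pos_of_numEdges_pos hm
  rw [haltProb_edgeSampler (g := fun a b => if Q.graph.Adj a b then 1 else 0) (v := 1) hn hδ
    (fun σ h => Set.indicator_of_mem (s := returnsSomeEdge Q ∪ returnsNoEdge) (Or.inr h.result) _)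
    (fun a b σ h => ?_) hσ]
  · simp only [hitValue_adj]
    exact stagedValue_eq_one (hitValue_one_add_failProb_of_lt Q hn) (Nat.zero_le _)
  · simp [Set.indicator_apply, h.mem_returnsSomeEdge_iff, h.notMem_returnsNoEdge]

theorem ofReal_one_sub_le_haltProb_edgeSampler (hm : 0 < Q.numEdges) (hδ : 0 < δ) (hδ1 : δ < 1)
    (hσ : SamplerInput n η δ σ) :
    ENNReal.ofReal (1 - δ) ≤ haltProb Q edgeSampler σ (returnsSomeEdge Q) := by
  classical
  have hn := Q.pos_of_numEdges_pos hm
  have hn1 : (1 : ℝ) ≤ n := by exact_mod_cast hn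
  have htA := goodTrials_le (A := numTrials n δ) hm
  rw [haltProb_edgeSampler (g := fun a b => if Q.graph.Adj a b then 1 else 0) (v := 0) hn hδ
    (fun σ h => Set.indicator_of_notMem h.notMem_returnsSomeEdge _) (fun a b σ h => ?_) hσ]
  · have hstaged := le_stagedValue_zero_add (κ := 1) (v := 0) htA
      (fun k hk => hitValue_one_add_failProb_of_lt Q hn k (hk.trans_le htA))
      fun k _ => (one_mul _).le
    simp only [hitValue_adj]
    rw [one_mul] at hstaged
    have hfail := prod_failProb_numTrials_le Q hm hδ hδ1
    exact ofReal_one_sub_le (hstaged.trans (add_le_add_right hfail _))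
      (div_le_self hδ.le (by nlinarith)) hδ.le
  · simp [Set.indicator_apply, h.mem_returnsSomeEdge_iff]

open Classical in
theorem haltProb_edgeSampler_returnsEdge (hn : 0 < n) (hδ : 0 < δ) (hσ : SamplerInput n η δ σ) :
    haltProb Q edgeSampler σ (returnsEdge e) =
      stagedValue (fun k => failProb Q (numTrials n δ / (k + 1)))
        (fun k => hitValue Q (numTrials n δ / (k + 1)) fun a b => if s(a, b) = e then 1 else 0) 0
        (numTrials n δ) 0 :=
  haltProb_edgeSampler hn hδ (fun σ h => Set.indicator_of_notMem h.notMem_returnsEdge _)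
    (fun a b σ h => by simp [Set.indicator_apply, h.mem_returnsEdge_iff]) hσ

theorem threshold_pos_of_lt_goodTrials (hm : 0 < Q.numEdges) {A k : ℕ}
    (hk : k < goodTrials A Q.numEdges) : 0 < (A : ℝ) / (k + 1) :=
  zero_lt_one.trans_le (one_le_threshold (hk.trans_le (goodTrials_le hm)))

theorem le_haltProb_edgeSampler_returnsEdge (hm : 0 < Q.numEdges) (hδ : 0 < δ) (hδ1 : δ < 1)
    (hσ : SamplerInput n η δ σ) (he : e ∈ Q.graph.edgeSet) :
    ENNReal.ofReal ((1 - 1 / 10) / Q.numEdges) ≤ haltProb Q edgeSampler σ (returnsEdge e) := by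
  classical
  have hn := Q.pos_of_numEdges_pos hm
  have hm1 : (1 : ℝ) ≤ Q.numEdges := by exact_mod_cast hm
  have htA := goodTrials_le (A := numTrials n δ) hm
  have hstaged := le_stagedValue_zero_add (v := 0) htA
    (fun k hk => hitValue_one_add_failProb_of_lt Q hn k (hk.trans_le htA)) fun k hk =>
      le_hitValue_edge hm (threshold_pos_of_lt_goodTrials hm hk) (le_threshold_sq hm hk) he
  have hloss : ENNReal.ofReal (19 / 20 / Q.numEdges) *
      ∏ k ∈ Finset.range (goodTrials (numTrials n δ) Q.numEdges),
        failProb Q (numTrials n δ / (k + 1)) ≤ ENNReal.ofReal (1 / 20 / Q.numEdges) :=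
    calc _ ≤ ENNReal.ofReal (19 / 20 / Q.numEdges) * ENNReal.ofReal (1 / 40 / Q.numEdges) := by
          gcongr
          exact (prod_failProb_numTrials_le Q hm hδ hδ1).trans
            (ENNReal.ofReal_le_ofReal (div_twenty_mul_sq_le Q hm hδ1))
      _ ≤ ENNReal.ofReal (1 / 20 / Q.numEdges) := by
          rw [← ENNReal.ofReal_mul (by positivity)]
          refine ENNReal.ofReal_le_ofReal ?_
          rw [div_mul_eq_mul_div]
          gcongr
          linarith [div_le_self (show (0 : ℝ) ≤ 1 / 40 by norm_num) hm1]
  rw [haltProb_edgeSampler_returnsEdge hn hδ hσ]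
  calc ENNReal.ofReal ((1 - 1 / 10) / Q.numEdges)
      = ENNReal.ofReal (19 / 20 / Q.numEdges) - ENNReal.ofReal (1 / 20 / Q.numEdges) := by
        rw [← ENNReal.ofReal_sub _ (by positivity)]
        congr 1
        ring
    _ ≤ _ := tsub_le_iff_right.2 (hstaged.trans (by gcongr))

theorem haltProb_edgeSampler_returnsEdge_le (hm : 0 < Q.numEdges) (hδ : 0 < δ) (hδ1 : δ < 1)
    (hσ : SamplerInput n η δ σ) (he : e ∈ Q.graph.edgeSet) :
    haltProb Q edgeSampler σ (returnsEdge e) ≤ ENNReal.ofReal ((1 + 1 / 10) / Q.numEdges) := by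
  classical
  have hn := Q.pos_of_numEdges_pos hm
  have htA := goodTrials_le (A := numTrials n δ) hm
  have hone := hitValue_one_add_failProb_of_lt Q hn (A := numTrials n δ)
  rw [haltProb_edgeSampler_returnsEdge hn hδ hσ]
  refine (stagedValue_zero_le_add htA (fun k hk => hone k (hk.trans_le htA)) fun k hk =>
    hitValue_edge_le hm (threshold_pos_of_lt_goodTrials hm hk) (le_threshold_sq hm hk) he).trans ?_
  calc _ ≤ ENNReal.ofReal (20 / 19 / Q.numEdges) + ENNReal.ofReal (1 / 40 / Q.numEdges) * 1 := by
        gcongr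
        · exact (prod_failProb_numTrials_le Q hm hδ hδ1).trans
            (ENNReal.ofReal_le_ofReal (div_twenty_mul_sq_le Q hm hδ1))
        · refine stagedValue_le_one (fun k hk => ?_) zero_le_one htA
          exact (add_le_add_left (hitValue_edge_le_hitValue_one Q _ e) _).trans_eq (hone k hk)
    _ ≤ _ := by
        rw [mul_one, ← ENNReal.ofReal_add (by positivity) (by positivity), ← add_div]
        exact ENNReal.ofReal_le_ofReal (div_le_div_of_nonneg_right (by norm_num) (by positivity))

theorem samplesAlmostUniformly_edgeSampler : SamplesAlmostUniformly edgeSampler (1 / 10) :=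
  fun _ _ _ _ hm hδ hδ1 hσ =>
    ⟨haltProb_edgeSampler_union hm hδ hσ, ofReal_one_sub_le_haltProb_edgeSampler hm hδ hδ1 hσ,
      fun _ he => ⟨le_haltProb_edgeSampler_returnsEdge hm hδ hδ1 hσ he,
        haltProb_edgeSampler_returnsEdge_le hm hδ hδ1 hσ he⟩⟩

end Correctness

section Complexity

variable {n : ℕ} {Q : QueryGraph n} {δ η : ℝ} {σ : Store ℕ}

theorem QueryGraph.one_le_div_sqrt_numEdges (hm : 0 < Q.numEdges) :
    1 ≤ (n : ℝ) / √(Q.numEdges : ℝ) := by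
  rw [one_le_div (by positivity)]
  refine Real.sqrt_le_iff.2 ⟨by positivity, ?_⟩
  linarith [Q.two_mul_numEdges_le_sq, Q.numEdges.cast_nonneg (α := ℝ)]

theorem numDoublings_ratio_le (hn : 0 < n) (hδ : 0 < δ) (hδ1 : δ < 1) :
    (numDoublings δ (20 * n ^ 2) : ℝ) ≤ 6 * (1 + Real.log n) * (1 + Real.log (1 / δ)) := by
  have hn1 : (1 : ℝ) ≤ n := by exact_mod_cast hn
  have hlogn : 0 ≤ Real.log n := Real.log_nonneg hn1
  have hlogδ : 0 ≤ Real.log (1 / δ) := Real.log_nonneg ((one_le_div hδ).2 hδ1.le)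
  have hlog20 : Real.log 20 ≤ 5 * Real.log 2 := by
    have h := Real.log_le_log (by norm_num) (show (20 : ℝ) ≤ 2 ^ 5 by norm_num)
    rw [Real.log_pow] at h
    exact_mod_cast h
  have hlen := numDoublings_mul_log_two_lt hδ (show δ ≤ 20 * (n : ℝ) ^ 2 by nlinarith)
  rw [div_eq_mul_one_div, Real.log_mul (by positivity) (by positivity),
    Real.log_mul (by norm_num) (by positivity), Real.log_pow] at hlen
  push_cast at hlen
  have hlog2 := Real.log_two_gt_d9
  refine le_of_mul_le_mul_right (a := Real.log 2) ?_ (by linarith)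
  nlinarith [mul_nonneg hlogn hlogδ]

theorem goodTrials_numTrials_le (hm : 0 < Q.numEdges) :
    (goodTrials (numTrials n δ) Q.numEdges : ℝ) ≤
      160 * (n / √(Q.numEdges : ℝ)) * numDoublings δ (20 * n ^ 2) :=
  calc (goodTrials (numTrials n δ) Q.numEdges : ℝ) ≤ numTrials n δ / √(40 * Q.numEdges) :=
        Nat.floor_le (by positivity)
    _ ≤ numTrials n δ / √(Q.numEdges : ℝ) := by
        gcongr
        linarith [Q.numEdges.cast_nonneg (α := ℝ)]
    _ = _ := by
        rw [numTrials]
        push_cast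
        ring

theorem div_mul_numTrials_le (hn : 0 < n) (hδ : 0 < δ) (hδ1 : δ < 1) :
    δ / (20 * n ^ 2) * (numTrials n δ * 62 + 1) ≤ 600 * numDoublings δ (20 * n ^ 2) := by
  have hn1 : (1 : ℝ) ≤ n := by exact_mod_cast hn
  have hL : (1 : ℝ) ≤ numDoublings δ (20 * n ^ 2) := by
    exact_mod_cast numDoublings_ratio_pos hn hδ hδ1
  rw [div_mul_eq_mul_div, div_le_iff₀ (by positivity), numTrials]
  push_cast
  have hnL : (n : ℝ) * numDoublings δ (20 * n ^ 2) ≤ n ^ 2 * numDoublings δ (20 * n ^ 2) := by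
    gcongr
    nlinarith
  have hone : 1 ≤ (n : ℝ) * numDoublings δ (20 * n ^ 2) := by nlinarith
  nlinarith

theorem expectedTime_edgeSampler_le_goodTrials (hm : 0 < Q.numEdges) (hδ : 0 < δ) (hδ1 : δ < 1)
    (hσ : SamplerInput n η δ σ) :
    expectedTime Q edgeSampler σ ≤ ENNReal.ofReal (numDoublings δ (20 * n ^ 2) * 6 + 26 +
      (goodTrials (numTrials n δ) Q.numEdges * 62 +
        δ / (20 * n ^ 2) * (numTrials n δ * 62 + 1))) := by
  have hn := Q.pos_of_numEdges_pos hm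
  set L := numDoublings δ (20 * n ^ 2)
  set t := goodTrials (numTrials n δ) Q.numEdges
  have hc (k : ℕ) (hk : k < numTrials n δ) : failProb Q (numTrials n δ / (k + 1)) ≤ 1 :=
    failProb_le_one Q hn (one_le_threshold hk)
  calc expectedTime Q edgeSampler σ
      ≤ L * 6 + 26 + (t * 62 + (∏ k ∈ Finset.range t, failProb Q (numTrials n δ / (k + 1))) *
          (numTrials n δ * 62 + 1)) :=
        (expectedTime_edgeSampler_le hn hδ hσ).trans
          (add_le_add_right (stagedValue_const_zero_le hc (goodTrials_le hm)) _)
    _ ≤ L * 6 + 26 + (t * 62 +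
          ENNReal.ofReal (δ / (20 * n ^ 2)) * (numTrials n δ * 62 + 1)) := by
        gcongr
        exact prod_failProb_numTrials_le Q hm hδ hδ1
    _ = ENNReal.ofReal (L * 6 + 26 + (t * 62 + δ / (20 * n ^ 2) * (numTrials n δ * 62 + 1))) := by
        have hcast (a b c : ℕ) : ENNReal.ofReal ((a : ℝ) * b + c) = a * b + c := by
          exact_mod_cast ENNReal.ofReal_natCast (a * b + c)
        have hcastL := hcast L 6 26
        have hcastA := hcast (numTrials n δ) 62 1
        have hcastt := hcast t 62 0
        push_cast [add_zero] at hcastL hcastA hcastt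
        rw [ENNReal.ofReal_add (by positivity) (by positivity), hcastL,
          ENNReal.ofReal_add (by positivity) (by positivity), hcastt,
          ENNReal.ofReal_mul (by positivity), hcastA]

theorem expectedTime_edgeSampler_le_ofReal (hm : 0 < Q.numEdges) (hδ : 0 < δ) (hδ1 : δ < 1)
    (hσ : SamplerInput n η δ σ) :
    expectedTime Q edgeSampler σ ≤ ENNReal.ofReal
      (70000 * (n / √(Q.numEdges : ℝ)) * (1 + Real.log n) * (1 + Real.log (1 / δ))) := by
  have hn := Q.pos_of_numEdges_pos hm
  set L := (numDoublings δ (20 * n ^ 2) : ℝ)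
  set X : ℝ := n / √(Q.numEdges : ℝ)
  have hL : 1 ≤ L := Nat.one_le_cast.2 (numDoublings_ratio_pos hn hδ hδ1)
  have hX : 1 ≤ X := Q.one_le_div_sqrt_numEdges hm
  have hlogδ : 0 ≤ Real.log (1 / δ) := Real.log_nonneg ((one_le_div hδ).2 hδ1.le)
  refine (expectedTime_edgeSampler_le_goodTrials hm hδ hδ1 hσ).trans (ENNReal.ofReal_le_ofReal ?_)
  calc _ ≤ L * 6 + 26 + (160 * X * L * 62 + 600 * L) := by
        linarith [goodTrials_numTrials_le (δ := δ) hm, div_mul_numTrials_le hn hδ hδ1]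
    _ ≤ 11000 * X * L := by
        linarith [show L ≤ X * L from le_mul_of_one_le_left (by positivity) hX]
    _ ≤ 11000 * X * (6 * (1 + Real.log n) * (1 + Real.log (1 / δ))) := by
        gcongr
        exact numDoublings_ratio_le hn hδ hδ1
    _ = 66000 * X * (1 + Real.log n) * (1 + Real.log (1 / δ)) := by ring
    _ ≤ 70000 * X * (1 + Real.log n) * (1 + Real.log (1 / δ)) := by
        gcongr
        norm_num

theorem samplerComplexity_edgeSampler : SamplerComplexity edgeSampler (1 / 10) := by
  refine ⟨70000, 1, fun n Q δ σ hm hδ hδ1 hσ => ?_⟩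
  have hlogδ : 0 ≤ Real.log (1 / δ) := Real.log_nonneg ((one_le_div hδ).2 hδ1.le)
  have h := (expectedTime_edgeSampler_le_ofReal hm hδ hδ1 hσ).trans <| ENNReal.ofReal_le_ofReal <|
    show _ ≤ 70000 * (n / √(1 / 10 * Q.numEdges)) * (1 + Real.log n) ^ 1 *
      (1 + Real.log (1 / δ)) ^ 1 by
      rw [pow_one, pow_one]
      gcongr
      linarith [Q.numEdges.cast_nonneg (α := ℝ)]
  exact ⟨(expectedQueries_le_expectedTime Q _ σ).trans h, h⟩

end Complexity

/-! ### Running time of Estimate-high-edges -/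

section EstimateHighEdgesTime

variable {n : ℕ} {Q : QueryGraph n} {α ε δ : ℝ} {σ : Store EheReg}

theorem numDoublings_two_le (hδ : 0 < δ) (hδ1 : δ < 1) :
    (numDoublings δ 2 : ℝ) ≤ 2 * (1 + Real.log (1 / δ)) := by
  have hlogδ : 0 ≤ Real.log (1 / δ) := Real.log_nonneg ((one_le_div hδ).2 hδ1.le)
  have hlen := numDoublings_mul_log_two_lt hδ (show δ ≤ 2 by linarith)
  rw [div_eq_mul_one_div, Real.log_mul (by norm_num) (by positivity)] at hlen
  have hlog2 := Real.log_two_gt_d9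
  refine le_of_mul_le_mul_right (a := Real.log 2) ?_ (by linarith)
  nlinarith

theorem numSamples_le (hε : 0 < ε) (hε1 : ε < 1) (hδ : 0 < δ) (hδ1 : δ < 1) :
    (numSamples ε δ : ℝ) ≤ 202 * (1 + Real.log (1 / δ)) / ε := by
  have hlogδ : 0 ≤ Real.log (1 / δ) := Real.log_nonneg ((one_le_div hδ).2 hδ1.le)
  rw [le_div_iff₀ hε]
  linarith [numSamples_mul_lt hε δ, numDoublings_two_le hδ hδ1]

theorem log_two_mul_numSamples_le (hε : 0 < ε) (hε1 : ε < 1) (hδ : 0 < δ) (hδ1 : δ < 1) :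
    Real.log (2 * numSamples ε δ) ≤ 7 + Real.log (1 / δ) + Real.log (1 / ε) := by
  have hlogδ : 0 ≤ Real.log (1 / δ) := Real.log_nonneg ((one_le_div hδ).2 hδ1.le)
  have hr : (0 : ℝ) < numSamples ε δ := Nat.cast_pos.2 (numSamples_pos hε hδ (by linarith))
  have hle : 2 * (numSamples ε δ : ℝ) ≤ 2 ^ 9 * (1 + Real.log (1 / δ)) * (1 / ε) := by
    calc 2 * (numSamples ε δ : ℝ) ≤ 2 * (202 * (1 + Real.log (1 / δ)) / ε) := by
          gcongr
          exact numSamples_le hε hε1 hδ hδ1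
      _ = 404 * (1 + Real.log (1 / δ)) * (1 / ε) := by ring
      _ ≤ 2 ^ 9 * (1 + Real.log (1 / δ)) * (1 / ε) := by
          gcongr
          norm_num
  have hlog := Real.log_le_log (by positivity) hle
  have hsplit : Real.log (2 ^ 9 * (1 + Real.log (1 / δ)) * (1 / ε)) =
      9 * Real.log 2 + Real.log (1 + Real.log (1 / δ)) + Real.log (1 / ε) := by
    rw [Real.log_mul (by positivity) (by positivity), Real.log_mul (by norm_num) (by positivity),
      Real.log_pow, Nat.cast_ofNat]
  linarith [Real.log_le_sub_one_of_pos (show 0 < 1 + Real.log (1 / δ) by linarith),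
    Real.log_two_lt_d9]

theorem one_add_log_failureParam_le (hε : 0 < ε) (hε1 : ε < 1) (hδ : 0 < δ) (hδ1 : δ < 1) :
    1 + Real.log (1 / (δ / (2 * numSamples ε δ))) ≤
      8 * (1 + Real.log (1 / δ)) * (1 + Real.log (1 / ε)) := by
  have hlogδ : 0 ≤ Real.log (1 / δ) := Real.log_nonneg ((one_le_div hδ).2 hδ1.le)
  have hlogε : 0 ≤ Real.log (1 / ε) := Real.log_nonneg ((one_le_div hε).2 hε1.le)
  have hr : (0 : ℝ) < numSamples ε δ := Nat.cast_pos.2 (numSamples_pos hε hδ (by linarith))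
  rw [one_div_div, div_eq_mul_one_div, Real.log_mul (by positivity) (by positivity)]
  nlinarith [log_two_mul_numSamples_le hε hε1 hδ hδ1, mul_nonneg hlogδ hlogε]

theorem expectedTime_estimateHighEdges_edgeSampler_le_numSamples (hm : 0 < Q.numEdges)
    (hε : 0 < ε) (hε1 : ε < 1) (hδ : 0 < δ) (hδ1 : δ < 1) (hσ : EheInput n α ε δ σ) :
    expectedTime Q (estimateHighEdges edgeSampler) σ ≤ ENNReal.ofReal
      (numDoublings δ 2 * 6 + numSamples ε δ * (37 + 560000 * (n / √(Q.numEdges : ℝ)) *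
        (1 + Real.log n) * ((1 + Real.log (1 / δ)) * (1 + Real.log (1 / ε)))) + 68) := by
  have hlogδ : 0 ≤ Real.log (1 / δ) := Real.log_nonneg ((one_le_div hδ).2 hδ1.le)
  have hlogε : 0 ≤ Real.log (1 / ε) := Real.log_nonneg ((one_le_div hε).2 hε1.le)
  obtain ⟨hδ', hδ'1⟩ := failureParam_mem_Ioo hε hδ hδ1
  set B := 560000 * (n / √(Q.numEdges : ℝ)) * (1 + Real.log n) *
    ((1 + Real.log (1 / δ)) * (1 + Real.log (1 / ε)))
  have hB : 0 ≤ B := by positivity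
  have hsampler (s : Store ℕ) (hs : SamplerInput n (1 / 10) (δ / (2 * numSamples ε δ)) s) :
      expectedTime Q edgeSampler s ≤ ENNReal.ofReal B := by
    refine (expectedTime_edgeSampler_le_ofReal hm hδ' hδ'1 hs).trans (ENNReal.ofReal_le_ofReal ?_)
    calc _ ≤ 70000 * (n / √(Q.numEdges : ℝ)) * (1 + Real.log n) *
          (8 * (1 + Real.log (1 / δ)) * (1 + Real.log (1 / ε))) := by
          gcongr
          exact one_add_log_failureParam_le hε hε1 hδ hδ1
      _ = B := by ring
  clear_value B
  refine (expectedTime_estimateHighEdges_le hε hδ hσ hsampler).trans_eq ?_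
  rw [ENNReal.ofReal_add (by positivity) (by positivity),
    ENNReal.ofReal_add (by positivity) (by positivity), ENNReal.ofReal_mul (by positivity),
    ENNReal.ofReal_mul (Nat.cast_nonneg _), ENNReal.ofReal_add (by norm_num) hB]
  simp

theorem expectedTime_estimateHighEdges_edgeSampler_le (hm : 0 < Q.numEdges)
    (hε : 0 < ε) (hε1 : ε < 1) (hδ : 0 < δ) (hδ1 : δ < 1) (hσ : EheInput n α ε δ σ) :
    expectedTime Q (estimateHighEdges edgeSampler) σ ≤ ENNReal.ofReal (300000000 *
      ((n / √(Q.numEdges : ℝ)) * ((1 + Real.log (1 / ε)) / ε)) * (1 + Real.log n) ^ 2 *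
        (1 + Real.log (1 / δ)) ^ 2) := by
  refine (expectedTime_estimateHighEdges_edgeSampler_le_numSamples hm hε hε1 hδ hδ1 hσ).trans
    (ENNReal.ofReal_le_ofReal ?_)
  set X : ℝ := n / √(Q.numEdges : ℝ)
  set a := 1 + Real.log n
  set b := 1 + Real.log (1 / δ)
  set e := 1 + Real.log (1 / ε)
  have hX : 1 ≤ X := Q.one_le_div_sqrt_numEdges hm
  have ha : 1 ≤ a := le_add_of_nonneg_right (Real.log_natCast_nonneg n)
  have hb : 1 ≤ b := le_add_of_nonneg_right (Real.log_nonneg ((one_le_div hδ).2 hδ1.le))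
  have he : 1 ≤ e := le_add_of_nonneg_right (Real.log_nonneg ((one_le_div hε).2 hε1.le))
  have hY : 1 ≤ X * a * (b * e) := one_le_mul_of_one_le_of_one_le
    (one_le_mul_of_one_le_of_one_le hX ha) (one_le_mul_of_one_le_of_one_le hb he)
  have hr : (1 : ℝ) ≤ numSamples ε δ :=
    Nat.one_le_cast.2 (numSamples_pos hε hδ (by linarith))
  have hℓr : (numDoublings δ 2 : ℝ) ≤ numSamples ε δ := by
    nlinarith [le_numSamples_mul hε δ, (numDoublings δ 2).cast_nonneg (α := ℝ)]
  have hrY : (numSamples ε δ : ℝ) ≤ numSamples ε δ * (X * a * (b * e)) :=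
    le_mul_of_one_le_right (by positivity) hY
  calc _ ≤ (numSamples ε δ : ℝ) * (600000 * (X * a * (b * e))) := by linarith
    _ ≤ 202 * b / ε * (600000 * (X * a * (b * e))) := by
        gcongr
        exact numSamples_le hε hε1 hδ hδ1
    _ = 121200000 * (X * (e / ε)) * a * b ^ 2 := by ring
    _ ≤ 300000000 * (X * (e / ε)) * a ^ 2 * b ^ 2 := by
        gcongr
        · norm_num
        · exact le_self_pow₀ ha two_ne_zero

end EstimateHighEdgesTime

end

/-- First part: with any procedure `S` that samples edges almost uniformly (accuracy `0.1`),
Estimate-high-edges returns MANY or FEW, and each is the answer with probability at least `1 - δ`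
when it should be. Second part: such procedures exist, within the stated complexity of almost
uniform edge sampling, and with one of them the expected query complexity and running time of
Estimate-high-edges are `Õ((n/√m) · log(1/ε)/ε) · polylog(1/δ)`. -/
theorem mainTheorem4 :
    (∀ S : Prog ℕ, SamplesAlmostUniformly S (1 / 10) →
      ∀ (n : ℕ) (Q : QueryGraph n) (α ε δ : ℝ) (σ : Store EheReg),
        0 < Q.numEdges → 0 < ε → ε < 1 → 0 < δ → δ < 1 → EheInput n α ε δ σ →
          haltProb Q (estimateHighEdges S) σ (answersMany ∪ answersFew) = 1 ∧
          (4 * ε * Q.numEdges < (Q.numHighEdges α ε : ℝ) →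
            ENNReal.ofReal (1 - δ) ≤ haltProb Q (estimateHighEdges S) σ answersMany) ∧
          ((Q.numHighEdges α ε : ℝ) ≤ 2 * ε * Q.numEdges →
            ENNReal.ofReal (1 - δ) ≤ haltProb Q (estimateHighEdges S) σ answersFew)) ∧
    (∃ S : Prog ℕ, SamplesAlmostUniformly S (1 / 10) ∧ SamplerComplexity S (1 / 10) ∧
      ∃ (C : ℝ) (k : ℕ),
        ∀ (n : ℕ) (Q : QueryGraph n) (α ε δ : ℝ) (σ : Store EheReg),
          0 < Q.numEdges → 0 < ε → ε < 1 → 0 < δ → δ < 1 → EheInput n α ε δ σ →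
            let bound := ENNReal.ofReal (C * ((n / √(Q.numEdges : ℝ)) *
              ((1 + Real.log (1 / ε)) / ε)) * (1 + Real.log n) ^ k *
                (1 + Real.log (1 / δ)) ^ k)
            expectedQueries Q (estimateHighEdges S) σ ≤ bound ∧
            expectedTime Q (estimateHighEdges S) σ ≤ bound) := by
  refine ⟨fun S hS n Q α ε δ σ hm hε _ hδ hδ1 hσ =>
      ⟨haltProb_estimateHighEdges_answers hS hm hε hδ hδ1 hσ,
        ofReal_one_sub_le_haltProb_answersMany hS hm hε hδ hδ1 hσ,
        ofReal_one_sub_le_haltProb_answersFew hS hm hε hδ hδ1 hσ⟩,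
    edgeSampler, samplesAlmostUniformly_edgeSampler, samplerComplexity_edgeSampler,
    300000000, 2, fun n Q α ε δ σ hm hε hε1 hδ hδ1 hσ => ?_⟩
  have htime := expectedTime_estimateHighEdges_edgeSampler_le hm hε hε1 hδ hδ1 hσ
  exact ⟨(expectedQueries_le_expectedTime Q _ σ).trans htime, htime⟩
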